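/- **Theorem.** Every connected graph $G$ has a rooted tree-decomposition of finite adhesion, into connected parts and with upwards disjoint separators, that displays all topological ends of $G$. Here the terms are as follows. Graphs are simple, non-empty when connected, and of arbitrary cardinality. *Ends.* A *ray* is a one-way infinite path; its subrays are its *tails*. Two rays of $G$ are equivalent if no finite set of vertices separates them, and the *ends* of $G$ are the equivalence classes of rays. An end *lives in* a component of an induced subgraph $G[B]$ if this component contains a tail of every ray of the end. A vertex $v$ *dominates* an end $\varepsilon$ if for some ray $R\in\varepsilon$ there is a subdivided infinite star with centre $v$ all whose leaves lie on $R$. The *topological* ends are those not dominated by any vertex. *Tree-decompositions.* A *rooted tree-decomposition* of $G$ is a pair $(T,(V_t)_{t\in T})$ of a rooted tree $T$ and a family of vertex sets $V_t\subseteq V(G)$ (the *parts*) such that (T1) every vertex of $G$ lies in some $V_t$; (T2) both endvertices of every edge of $G$ lie in a common $V_t$; (T3) $V_{t_1}\cap V_{t_3}\subseteq V_{t_2}$ whenever $t_2$ lies on the path in $T$ from $t_1$ to $t_3$. It is *into connected parts* if every $G[V_t]$ is connected. An edge $e=xy$ of $T$ induces the separator $X_e=V_x\cap V_y$; *finite adhesion*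 means that all $X_e$ are finite. *Upwards disjoint separators* means that $X_e\cap X_{e'}=\emptyset$ for any two distinct edges $e<e'$ of $T$ that are comparable in the tree order, i.e. such that $e$ lies on the path in $T$ from the root to $e'$. *Displaying ends.* For an edge $e=xy$ of $T$ let $T_y$ be the component of $T-e$ containing $y$, and let $A_y=\bigcup_{t\in T_y}V_t$. An end $\varepsilon$ of $G$ orients $e$ towards $y$ if it lives in a component of $G[A_y]-X_e$. The end $\varepsilon$ *lives in* an end $\omega$ of $T$ if it orients every edge of $T$ towards $\omega$, that is, towards the side in which the rays of $\omega$ have tails. The tree-decomposition *displays* a set $\Psi$ of ends of $G$ if in every end of $T$ there lives exactly one end of $G$, and this end is in $\Psi$, and conversely every end in $\Psi$ lives in some end of $T$. -/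

import Mathlib

universe u v

namespace SimpleGraph


/-! ### Rays and ends -/

/-- A ray of `G`: a one-way infinite path `R 0, R 1, R 2, …` in `G`. -/
structure Ray {V : Type u} (G : SimpleGraph V) where
  vertex : ℕ → V
  injective : Function.Injective vertex
  adj : ∀ n, G.Adj (vertex n) (vertex (n + 1))

/-- The set of vertices on a ray. -/
def Ray.verts {V : Type u} {G : SimpleGraph V} (R : G.Ray) : Set V :=
  Set.range R.vertex

/-- The vertex set `S` separates `A` from `B` in `G`: every walk (equivalently, every path) of `G`
from a vertex of `A` to a vertex of `B` meets `S`. -/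
def Separates {V : Type u} (G : SimpleGraph V) (S A B : Set V) : Prop :=
  ∀ a ∈ A, ∀ b ∈ B, ∀ p : G.Walk a b, ∃ x ∈ p.support, x ∈ S

/-- Two rays are equivalent if no finite set of vertices separates them. -/
def Ray.Equivalent {V : Type u} {G : SimpleGraph V} (R R' : G.Ray) : Prop :=
  ∀ S : Set V, S.Finite → ¬ G.Separates S R.verts R'.verts

theorem Ray.eventually_notMem {V : Type u} {G : SimpleGraph V} (R : G.Ray) {S : Set V}
    (hS : S.Finite) : ∃ N, ∀ n, N ≤ n → R.vertex n ∉ S := by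
  have hfin : (R.vertex ⁻¹' S).Finite := hS.preimage R.injective.injOn
  obtain ⟨N, hN⟩ := hfin.bddAbove
  exact ⟨N + 1, fun n hn hmem => absurd (hN hmem) (by omega)⟩

theorem Ray.exists_walk_add {V : Type u} {G : SimpleGraph V} (R : G.Ray) (m k : ℕ) :
    ∃ p : G.Walk (R.vertex m) (R.vertex (m + k)),
      ∀ x ∈ p.support, ∃ n, m ≤ n ∧ R.vertex n = x := by
  induction k with
  | zero => exact ⟨Walk.nil, fun x hx => ⟨m, le_rfl, by
      rw [Walk.support_nil, List.mem_singleton] at hx; exact hx.symm⟩⟩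
  | succ k ih =>
    obtain ⟨p, hp⟩ := ih
    refine ⟨p.concat (R.adj (m + k)), fun x hx => ?_⟩
    rw [Walk.support_concat, List.mem_append] at hx
    rcases hx with hx | hx
    · exact hp x hx
    · exact ⟨m + (k + 1), by omega, (List.mem_singleton.mp hx).symm⟩

theorem Ray.exists_walk {V : Type u} {G : SimpleGraph V} (R : G.Ray) (N m n : ℕ)
    (hm : N ≤ m) (hn : N ≤ n) :
    ∃ p : G.Walk (R.vertex m) (R.vertex n), ∀ x ∈ p.support, ∃ k, N ≤ k ∧ R.vertex k = x := by
  rcases le_total m n with h | h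
  · obtain ⟨k, rfl⟩ := Nat.exists_eq_add_of_le h
    obtain ⟨p, hp⟩ := R.exists_walk_add m k
    exact ⟨p, fun x hx => (hp x hx).imp fun _ hk => ⟨hm.trans hk.1, hk.2⟩⟩
  · obtain ⟨k, rfl⟩ := Nat.exists_eq_add_of_le h
    obtain ⟨p, hp⟩ := R.exists_walk_add n k
    refine ⟨p.reverse, fun x hx => ?_⟩
    rw [Walk.support_reverse, List.mem_reverse] at hx
    exact (hp x hx).imp fun _ hk => ⟨hn.trans hk.1, hk.2⟩

theorem Ray.equivalent_equivalence {V : Type u} (G : SimpleGraph V) :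
    Equivalence (Ray.Equivalent (G := G)) where
  refl R S hS hsep := by
    obtain ⟨N, hN⟩ := R.eventually_notMem hS
    obtain ⟨x, hx, hxS⟩ := hsep (R.vertex N) ⟨N, rfl⟩ (R.vertex N) ⟨N, rfl⟩ Walk.nil
    have hxN : x = R.vertex N := by simpa using hx
    exact hN N le_rfl (hxN ▸ hxS)
  symm := by
    intro R R' h S hS hsep
    refine h S hS fun a ha b hb p => ?_
    obtain ⟨x, hx, hxS⟩ := hsep b hb a ha p.reverse
    exact ⟨x, by simpa using hx, hxS⟩
  trans := by
    intro R₁ R₂ R₃ h₁ h₂ S hS hsep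
    obtain ⟨N, hN⟩ := R₂.eventually_notMem hS
    have hS' : (S ∪ R₂.vertex '' Set.Iio N).Finite := hS.union ((Set.finite_Iio N).image _)
    have k₁ := h₁ _ hS'
    have k₂ := h₂ _ hS'
    unfold Separates at k₁ k₂
    push Not at k₁ k₂
    obtain ⟨a, ha, b, ⟨m, rfl⟩, p, hp⟩ := k₁
    obtain ⟨c, ⟨n, rfl⟩, d, hd, q, hq⟩ := k₂
    have hm : N ≤ m := by
      by_contra hlt
      exact hp _ p.end_mem_support (Or.inr ⟨m, not_le.mp hlt, rfl⟩)
    have hn : N ≤ n := by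
      by_contra hlt
      exact hq _ q.start_mem_support (Or.inr ⟨n, not_le.mp hlt, rfl⟩)
    obtain ⟨r, hr⟩ := R₂.exists_walk N m n hm hn
    obtain ⟨x, hx, hxS⟩ := hsep a ha d hd ((p.append r).append q)
    rw [Walk.mem_support_append_iff, Walk.mem_support_append_iff] at hx
    rcases hx with (hx | hx) | hx
    · exact hp x hx (Or.inl hxS)
    · obtain ⟨k, hk, rfl⟩ := hr x hx
      exact hN k hk hxS
    · exact hq x hx (Or.inl hxS)

/-- Equivalence of rays, as a setoid. -/
def raySetoid {V : Type u} (G : SimpleGraph V) : Setoid G.Ray where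
  r := Ray.Equivalent
  iseqv := Ray.equivalent_equivalence G

/-- The ends of `G`: the equivalence classes of rays of `G`. -/
def GraphEnd {V : Type u} (G : SimpleGraph V) : Type u :=
  Quotient G.raySetoid

/-- The end of `G` to which a ray belongs. -/
def Ray.toEnd {V : Type u} {G : SimpleGraph V} (R : G.Ray) : G.GraphEnd :=
  Quotient.mk G.raySetoid R

/-- The end `ε` lives in a component of the subgraph `G[B]` induced by `B`: there is a component
of `G[B]` that contains a tail of every ray of `ε`. -/
def GraphEnd.LivesInComponentOf {V : Type u} {G : SimpleGraph V} (ε : G.GraphEnd) (B : Set V) :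
    Prop :=
  ∃ C : (G.induce B).ConnectedComponent, ∀ R : G.Ray, R.toEnd = ε →
    ∃ N, ∀ n, N ≤ n →
      ∃ h : R.vertex n ∈ B, (G.induce B).connectedComponentMk ⟨R.vertex n, h⟩ = C

/-! ### Dominated and topological ends -/

/-- A subdivided infinite star in `G`: infinitely many nontrivial paths of `G` that start in the
centre and are otherwise pairwise disjoint. Their last vertices are the leaves of the star. -/
structure SubdividedStar {V : Type u} (G : SimpleGraph V) where
  center : V
  leaf : ℕ → V
  leaf_ne_center : ∀ n, leaf n ≠ center
  path : ∀ n, G.Walk center (leaf n)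
  isPath : ∀ n, (path n).IsPath
  disjoint : ∀ m n, m ≠ n → ∀ x, x ∈ (path m).support → x ∈ (path n).support → x = center

/-- A star is attached to `U` if all its leaves lie in `U`. -/
def SubdividedStar.AttachedTo {V : Type u} {G : SimpleGraph V} (S : G.SubdividedStar)
    (U : Set V) : Prop :=
  ∀ n, S.leaf n ∈ U

/-- The vertex `x` dominates the end `ε` if there is a star with centre `x` attached to some ray
of `ε`. -/
def Dominates {V : Type u} {G : SimpleGraph V} (x : V) (ε : G.GraphEnd) : Prop :=
  ∃ S : G.SubdividedStar, S.center = x ∧ ∃ R : G.Ray, R.toEnd = ε ∧ S.AttachedTo R.verts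

/-- The topological ends of `G`: the ends that are dominated by no vertex. -/
def topologicalEnds {V : Type u} (G : SimpleGraph V) : Set G.GraphEnd :=
  {ε | ¬ ∃ x : V, Dominates x ε}

/-! ### Rooted trees -/

/-- The tree order of a tree `T` with root `r`: `x ≤ y` if `x` lies on the path from `r` to `y`. -/
def TreeLE {W : Type v} (T : SimpleGraph W) (r x y : W) : Prop :=
  ∃ p : T.Walk r y, p.IsPath ∧ x ∈ p.support

/-- For an edge `xy` of a tree `T`, the vertex set of the component `T_y` of `T - xy` that
contains `y`. -/
def sideOf {W : Type v} (T : SimpleGraph W) (x y : W) : Set W :=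
  {t | (T.deleteEdges {s(x, y)}).Reachable y t}

/-! ### Tree-decompositions -/

/-- A rooted tree-decomposition of `G`, whose decomposition tree has the nodes `W`. -/
structure RootedTreeDecomposition {V : Type u} (G : SimpleGraph V) (W : Type v) where
  tree : SimpleGraph W
  isTree : tree.IsTree
  root : W
  part : W → Set V
  exists_mem_part : ∀ x : V, ∃ t, x ∈ part t
  exists_edge_part : ∀ x y : V, G.Adj x y → ∃ t, x ∈ part t ∧ y ∈ part t
  inter_subset : ∀ (t₁ t₂ t₃ : W) (p : tree.Walk t₁ t₃), p.IsPath → t₂ ∈ p.support →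
    part t₁ ∩ part t₃ ⊆ part t₂

namespace RootedTreeDecomposition

/-- The separator induced by the edge `xy` of the decomposition tree. -/
def separator {V : Type u} {G : SimpleGraph V} {W : Type v} (D : G.RootedTreeDecomposition W)
    (x y : W) : Set V :=
  D.part x ∩ D.part y

/-- For an edge `xy` of the decomposition tree, the union `A_y` of all parts `V_t` with `t` in the
component of `T - xy` that contains `y`. -/
def side {V : Type u} {G : SimpleGraph V} {W : Type v} (D : G.RootedTreeDecomposition W)
    (x y : W) : Set V :=
  ⋃ t ∈ D.tree.sideOf x y, D.part t

/-- All separators induced by the edges of the decomposition tree are finite. -/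
def FiniteAdhesion {V : Type u} {G : SimpleGraph V} {W : Type v}
    (D : G.RootedTreeDecomposition W) : Prop :=
  ∀ x y, D.tree.Adj x y → (D.separator x y).Finite

/-- Every part induces a connected subgraph. -/
def ConnectedParts {V : Type u} {G : SimpleGraph V} {W : Type v}
    (D : G.RootedTreeDecomposition W) : Prop :=
  ∀ t, (G.induce (D.part t)).Connected

/-- The separators induced by two distinct comparable edges `e < e'` are disjoint. Here `e = xy`
and `e' = x'y'` with lower endvertices `x` and `x'`, and `e < e'` means that `y ≤ x'`. -/
def UpwardsDisjointSeparators {V : Type u} {G : SimpleGraph V} {W : Type v}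
    (D : G.RootedTreeDecomposition W) : Prop :=
  ∀ x y x' y', D.tree.Adj x y → D.tree.TreeLE D.root x y →
    D.tree.Adj x' y' → D.tree.TreeLE D.root x' y' →
    D.tree.TreeLE D.root y x' →
    Disjoint (D.separator x y) (D.separator x' y')

/-- The end `ε` of `G` orients the edge `xy` of the decomposition tree from `x` to `y`: it lives in
a component of `G[A_y] - X_{xy}`. -/
def Orients {V : Type u} {G : SimpleGraph V} {W : Type v} (D : G.RootedTreeDecomposition W)
    (ε : G.GraphEnd) (x y : W) : Prop :=
  ε.LivesInComponentOf (D.side x y \ D.separator x y)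

/-- The end `ε` of `G` lives in the end `ω` of the decomposition tree: it orients every edge of the
tree towards `ω`, that is, towards the side on which the rays of `ω` have a tail. -/
def LivesInEnd {V : Type u} {G : SimpleGraph V} {W : Type v} (D : G.RootedTreeDecomposition W)
    (ε : G.GraphEnd) (ω : D.tree.GraphEnd) : Prop :=
  ∀ x y, D.tree.Adj x y →
    (∀ R : D.tree.Ray, R.toEnd = ω → ∃ N, ∀ n, N ≤ n → R.vertex n ∈ D.tree.sideOf x y) →
    D.Orients ε x y

/-- The tree-decomposition displays the set `Ψ` of ends of `G`: in every end of the decomposition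
tree there lives a unique end of `G`, and it is in `Ψ`; and conversely every end in `Ψ` lives in
some end of the decomposition tree. -/
def Displays {V : Type u} {G : SimpleGraph V} {W : Type v} (D : G.RootedTreeDecomposition W)
    (Ψ : Set G.GraphEnd) : Prop :=
  (∀ ω : D.tree.GraphEnd,
    (∃! ε : G.GraphEnd, D.LivesInEnd ε ω) ∧ ∀ ε : G.GraphEnd, D.LivesInEnd ε ω → ε ∈ Ψ) ∧
  ∀ ε ∈ Ψ, ∃ ω : D.tree.GraphEnd, D.LivesInEnd ε ω

end RootedTreeDecomposition

end SimpleGraph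

/-! Regions, that is, non-empty connected vertex sets with finite boundary, are subdivided
recursively, beginning with the whole vertex set. A region C with boundary X receives a connected
part P with X ⊆ P ⊆ C ∪ X, and the components of C \ P become its child regions. The part is chosen
so that child regions have finite boundaries, do not touch X, and catch a tail of every ray in C
whose end is undominated (`IsRegion.exists_isPartOf`).

To find P, let U consist of a finite connected set containing X and of all neighbours of X in C. It
is enlarged to an envelope Z (`Connected.exists_envelope`) by a maximal disjoint family of rays that
no finite set separates from U, then by the vertices that no finite set of other vertices separates
from the result, then by paths back to U. If a component outside Z had infinitely many neighbours,
the star-comb lemma would give a vertex or a ray in it that should have been captured. The additions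
cling to U, so a ray clinging to Z clings to U, hence to the neighbourhood of the finite set X, and
its end is dominated by a vertex of X. No undominated end is therefore caught in P.

Since the boundary of a child lies inside its parent region, every edge of a walk leaves at most one
level, and the regions containing a fixed vertex have bounded depth (`RegionNode.depth_le_length`).
Hence the parts cover the graph, and the regions along a branch eventually avoid any finite set. So
a branch holds exactly one end: the star-comb lemma yields a ray with tails in all its regions, any
two such rays are joined inside late regions, and a vertex dominating their end would lie in every
region of the branch. Conversely, an undominated end descends through child regions forever. -/

namespace SimpleGraph

/-! ### Walks inside a set of vertices -/

/-- The vertices `a` and `b` are joined by a walk all whose vertices lie in `B`. -/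
def JoinedIn {V : Type u} (G : SimpleGraph V) (B : Set V) (a b : V) : Prop :=
  ∃ p : G.Walk a b, ∀ x ∈ p.support, x ∈ B

namespace JoinedIn

variable {V : Type u} {G : SimpleGraph V} {A B : Set V} {a b c : V}

theorem refl (h : a ∈ B) : G.JoinedIn B a a :=
  ⟨Walk.nil, fun x hx => by
    rw [Walk.support_nil, List.mem_singleton] at hx
    exact hx ▸ h⟩

theorem symm (h : G.JoinedIn B a b) : G.JoinedIn B b a := by
  obtain ⟨p, hp⟩ := h
  exact ⟨p.reverse, fun x hx => hp x (by simpa using hx)⟩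

theorem trans (h : G.JoinedIn B a b) (h' : G.JoinedIn B b c) : G.JoinedIn B a c := by
  obtain ⟨p, hp⟩ := h
  obtain ⟨q, hq⟩ := h'
  refine ⟨p.append q, fun x hx => ?_⟩
  rcases (Walk.mem_support_append_iff p q).mp hx with hx | hx
  · exact hp x hx
  · exact hq x hx

theorem mono (h : G.JoinedIn A a b) (hAB : A ⊆ B) : G.JoinedIn B a b := by
  obtain ⟨p, hp⟩ := h
  exact ⟨p, fun x hx => hAB (hp x hx)⟩

theorem of_adj (h : G.Adj a b) (ha : a ∈ B) (hb : b ∈ B) : G.JoinedIn B a b :=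
  ⟨Walk.cons h Walk.nil, fun x hx => by
    simp only [Walk.support_cons, Walk.support_nil, List.mem_cons, List.not_mem_nil,
      or_false] at hx
    rcases hx with rfl | rfl
    · exact ha
    · exact hb⟩

theorem left_mem (h : G.JoinedIn B a b) : a ∈ B := by
  obtain ⟨p, hp⟩ := h
  exact hp a p.start_mem_support

theorem right_mem (h : G.JoinedIn B a b) : b ∈ B := h.symm.left_mem

/-- A walk in `B` that leaves `A` does so along an edge. -/
theorem exists_exit (h : G.JoinedIn B a b) (ha : a ∈ A) (hb : b ∉ A) :
    ∃ x y, G.JoinedIn (B ∩ A) a x ∧ G.Adj x y ∧ y ∈ B ∧ y ∉ A := by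
  obtain ⟨p, hp⟩ := h
  induction p with
  | nil => exact absurd ha hb
  | @cons u v w huv p ih =>
    have hu : u ∈ B := hp u (by simp)
    have hv : v ∈ B := hp v (by simp)
    by_cases hvA : v ∈ A
    · obtain ⟨x, y, hx, hxy, hy, hyA⟩ := ih hvA hb fun x hx => hp x (by simp [hx])
      have h : G.JoinedIn (B ∩ A) u v := of_adj huv ⟨hu, ha⟩ ⟨hv, hvA⟩
      exact ⟨x, y, h.trans hx, hxy, hy, hyA⟩
    · have h : G.JoinedIn (B ∩ A) u u := refl ⟨hu, ha⟩
      exact ⟨u, v, h, huv, hv, hvA⟩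

theorem mem_of_closed (h : G.JoinedIn B a b) (ha : a ∈ A)
    (hA : ∀ x ∈ A, ∀ y ∈ B, G.Adj x y → y ∈ A) : b ∈ A := by
  by_contra hb
  obtain ⟨x, y, hx, hxy, hy, hyA⟩ := h.exists_exit ha hb
  exact hyA (hA x hx.right_mem.2 y hy hxy)

/-- A walk in `B` from `a` runs within the component of `a`. -/
theorem joinedIn_component (h : G.JoinedIn B a b) :
    G.JoinedIn {x | G.JoinedIn B a x} a b := by
  have ha : G.JoinedIn {x | G.JoinedIn B a x} a a := refl (refl h.left_mem)
  refine h.mem_of_closed (A := {x | G.JoinedIn {x | G.JoinedIn B a x} a x}) ha ?_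
  intro x hx y hy hxy
  have hax : G.JoinedIn B a x := hx.right_mem
  exact hx.trans (of_adj hxy hax (hax.trans (of_adj hxy hax.right_mem hy)))

theorem of_induce {D : Set V} {S : Set D} {a b : D} (h : (G.induce D).JoinedIn S a b) :
    G.JoinedIn (Subtype.val '' S) a b := by
  obtain ⟨p, hp⟩ := h
  refine ⟨p.map (Embedding.induce D).toHom, fun x hx => ?_⟩
  obtain ⟨y, hy, rfl⟩ := List.mem_map.mp ((Walk.support_map _ p) ▸ hx)
  exact ⟨y, hp y hy, rfl⟩

end JoinedIn

theorem Connected.joinedIn_univ {V : Type u} {G : SimpleGraph V} (hG : G.Connected) (a b : V) :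
    G.JoinedIn Set.univ a b := by
  obtain ⟨p⟩ := hG.preconnected a b
  exact ⟨p, fun _ _ => trivial⟩

theorem induce_connected_of_joinedIn {V : Type u} {G : SimpleGraph V} {B : Set V}
    (hne : B.Nonempty) (h : ∀ a ∈ B, ∀ b ∈ B, G.JoinedIn B a b) : (G.induce B).Connected := by
  obtain ⟨b, hb⟩ := hne
  refine connected_iff_exists_forall_reachable _ |>.mpr ⟨⟨b, hb⟩, fun y => ?_⟩
  obtain ⟨p, hp⟩ := h b hb y y.2
  exact ⟨p.induce B hp⟩

theorem Ray.joinedIn {V : Type u} {G : SimpleGraph V} (R : G.Ray) {B : Set V} {N m n : ℕ}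
    (hB : ∀ k, N ≤ k → R.vertex k ∈ B) (hm : N ≤ m) (hn : N ≤ n) :
    G.JoinedIn B (R.vertex m) (R.vertex n) := by
  obtain ⟨p, hp⟩ := R.exists_walk N m n hm hn
  refine ⟨p, fun x hx => ?_⟩
  obtain ⟨k, hk, rfl⟩ := hp x hx
  exact hB k hk

/-! ### Parent functions -/

/-- `q` maps every vertex outside `U` to a parent whose depth `d` is smaller by one, and fixes the
vertices in `U`, which have depth zero. -/
structure IsParentMap {W : Type v} (U : Set W) (q : W → W) (d : W → ℕ) : Prop where
  depth_eq_zero : ∀ w ∈ U, d w = 0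
  fixed : ∀ w ∈ U, q w = w
  depth_parent : ∀ w ∉ U, d (q w) + 1 = d w

namespace IsParentMap

variable {W : Type v} {U : Set W} {q : W → W} {d : W → ℕ}

theorem depth_parent_eq (h : IsParentMap U q d) (w : W) : d (q w) = d w - 1 := by
  by_cases hw : w ∈ U
  · rw [h.fixed w hw, h.depth_eq_zero w hw]
  · have := h.depth_parent w hw
    omega

theorem depth_iterate (h : IsParentMap U q d) (k : ℕ) (w : W) : d (q^[k] w) = d w - k := by
  induction k with
  | zero => simp
  | succ k ih =>
    rw [Function.iterate_succ_apply', h.depth_parent_eq, ih]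
    omega

theorem mem_of_depth_eq_zero (h : IsParentMap U q d) {w : W} (hw : d w = 0) : w ∈ U := by
  by_contra hU
  have := h.depth_parent w hU
  omega

theorem iterate_depth_mem (h : IsParentMap U q d) (w : W) : q^[d w] w ∈ U :=
  h.mem_of_depth_eq_zero (by rw [h.depth_iterate]; omega)

theorem iterate_of_mem (h : IsParentMap U q d) {w : W} (hw : w ∈ U) (k : ℕ) : q^[k] w = w :=
  Function.iterate_fixed (h.fixed w hw) k

theorem finite_ancestors (h : IsParentMap U q d) (w : W) : {v | ∃ k, q^[k] w = v}.Finite := by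
  refine ((Set.finite_Iic (d w)).image fun k => q^[k] w).subset ?_
  rintro v ⟨k, rfl⟩
  rcases le_total k (d w) with hk | hk
  · exact ⟨k, hk, rfl⟩
  · refine ⟨d w, Set.mem_Iic.mpr le_rfl, ?_⟩
    obtain ⟨j, rfl⟩ := Nat.exists_eq_add_of_le hk
    rw [add_comm, Function.iterate_add_apply]
    exact (h.iterate_of_mem (h.iterate_depth_mem w) j).symm

theorem joinedIn_iterate (h : IsParentMap U q d) {G : SimpleGraph W}
    (hadj : ∀ w ∉ U, G.Adj w (q w)) (w : W) (k : ℕ) :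
    G.JoinedIn {v | ∃ j ≤ k, q^[j] w = v} w (q^[k] w) := by
  induction k with
  | zero => exact JoinedIn.refl ⟨0, le_rfl, rfl⟩
  | succ k ih =>
    have ih' : G.JoinedIn {v | ∃ j ≤ k + 1, q^[j] w = v} w (q^[k] w) :=
      ih.mono fun v ⟨j, hj, hv⟩ => ⟨j, by omega, hv⟩
    rw [Function.iterate_succ_apply']
    by_cases hU : q^[k] w ∈ U
    · rw [h.fixed _ hU]
      exact ih'
    · exact ih'.trans (JoinedIn.of_adj (hadj _ hU) ⟨k, by omega, rfl⟩
        ⟨k + 1, le_rfl, Function.iterate_succ_apply' q k w⟩)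

end IsParentMap

/-- Breadth-first search from a non-empty set of vertices of a connected graph. -/
theorem Connected.exists_parentMap {V : Type u} {G : SimpleGraph V} (hG : G.Connected)
    {U : Set V} (hU : U.Nonempty) :
    ∃ (q : V → V) (d : V → ℕ), IsParentMap U q d ∧ ∀ v ∉ U, G.Adj v (q v) := by
  classical
  have hex : ∀ v, ∃ n, ∃ u ∈ U, ∃ p : G.Walk v u, p.length = n := fun v => by
    obtain ⟨u, hu⟩ := hU
    obtain ⟨p⟩ := hG.preconnected v u
    exact ⟨_, u, hu, p, rfl⟩
  -- The parent of a vertex outside `U` is the second vertex of a shortest walk to `U`.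
  have hstep : ∀ v, ∃ w, (v ∈ U → w = v) ∧
      (v ∉ U → G.Adj v w ∧ Nat.find (hex w) + 1 = Nat.find (hex v)) := fun v => by
    by_cases hv : v ∈ U
    · exact ⟨v, fun _ => rfl, fun h => absurd hv h⟩
    · obtain ⟨u, hu, p, hp⟩ := Nat.find_spec (hex v)
      cases p with
      | nil => exact absurd hu hv
      | @cons _ w _ hvw p =>
        refine ⟨w, fun h => absurd h hv, fun _ => ⟨hvw, ?_⟩⟩
        rw [Walk.length_cons] at hp
        have h₁ : Nat.find (hex w) ≤ p.length := Nat.find_min' _ ⟨u, hu, p, rfl⟩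
        obtain ⟨u', hu', p', hp'⟩ := Nat.find_spec (hex w)
        have h₂ : Nat.find (hex v) ≤ p'.length + 1 :=
          Nat.find_min' _ ⟨u', hu', Walk.cons hvw p', rfl⟩
        omega
  choose q hq hq' using hstep
  refine ⟨q, fun v => Nat.find (hex v), ⟨fun v hv => ?_, hq, fun v hv => (hq' v hv).2⟩,
    fun v hv => (hq' v hv).1⟩
  rw [Nat.find_eq_zero]
  exact ⟨v, hv, Walk.nil, rfl⟩

/-! ### Stars and combs -/

/-- A form of the star-comb lemma: an infinite family of vertices of a connected graph cannot be
separated finitely from some vertex, or from some ray. -/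
theorem Connected.star_comb {V : Type u} {G : SimpleGraph V} (hG : G.Connected) {ι : Type v}
    [Infinite ι] (f : ι → V) :
    (∃ v, ∀ S : Set V, S.Finite → v ∉ S → ∀ J : Set ι, J.Finite →
      ∃ i ∉ J, G.JoinedIn Sᶜ v (f i)) ∨
    ∃ R : G.Ray, ∀ S : Set V, S.Finite → ∀ J : Set ι, J.Finite →
      ∃ n, ∃ i ∉ J, G.JoinedIn Sᶜ (R.vertex n) (f i) := by
  obtain ⟨r⟩ := hG.nonempty
  obtain ⟨q, d, hq, hadj⟩ := hG.exists_parentMap (Set.singleton_nonempty r)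
  -- `T v` is the set of descendants of `v` in a breadth-first search tree rooted at `r`.
  set T : V → Set V := fun v => {w | d v ≤ d w ∧ q^[d w - d v] w = v} with hT
  have hTjoin : ∀ v, ∀ w ∈ T v, G.JoinedIn (T v) v w := by
    rintro v w ⟨hd, hw⟩
    have := hq.joinedIn_iterate hadj w (d w - d v)
    rw [hw] at this
    refine (this.mono ?_).symm
    rintro x ⟨j, hj, rfl⟩
    refine ⟨by rw [hq.depth_iterate]; omega, ?_⟩
    rw [hq.depth_iterate, ← Function.iterate_add_apply]
    convert hw using 2
    omega
  have hTself : ∀ v, v ∈ T v := fun v => ⟨le_rfl, by simp⟩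
  have hTroot : ∀ w, w ∈ T r := fun w => by
    refine ⟨by simp [hq.depth_eq_zero r rfl], ?_⟩
    rw [hq.depth_eq_zero r rfl]
    exact hq.iterate_depth_mem w
  have hTchild : ∀ v, ∀ w ∈ T v, w ≠ v →
      ∃ c, q c = v ∧ d c = d v + 1 ∧ c ∉ ({r} : Set V) ∧ w ∈ T c := by
    rintro v w ⟨hd, hw⟩ hne
    obtain ⟨k, hk⟩ := Nat.exists_eq_add_of_le hd
    rcases k with _ | k
    · rw [hk] at hw
      simp at hw
      exact absurd hw hne
    have hdc : d (q^[k] w) = d v + 1 := by rw [hq.depth_iterate]; omega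
    refine ⟨q^[k] w, ?_, hdc, fun hr => ?_, by omega, ?_⟩
    · rw [← Function.iterate_succ_apply' q k w]
      convert hw using 2
      omega
    · rw [hq.depth_eq_zero _ hr] at hdc
      omega
    · rw [hdc]
      congr 1
      omega
  have hTdisj : ∀ c c' w, d c = d c' → w ∈ T c → w ∈ T c' → c = c' := by
    rintro c c' w hd ⟨_, h₁⟩ ⟨_, h₂⟩
    rw [← h₁, ← h₂, hd]
  -- Either some subtree holds infinitely many indices while each child subtree holds only finitely
  -- many, and its top is the centre of a star; or one can always pass to a child with infinitely
  -- many, which traces a ray.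
  by_cases hstar : ∃ v, {i | f i ∈ T v}.Infinite ∧
      ∀ c, q c = v → d c = d v + 1 → {i | f i ∈ T c}.Finite
  · obtain ⟨v, hinf, hfin⟩ := hstar
    refine Or.inl ⟨v, fun S hS hvS J hJ => ?_⟩
    -- Subtrees of distinct children are disjoint, so only finitely many meet `S`. Any index outside
    -- these is joined to `v` through a child subtree avoiding `S`, unless it sits at `v` itself.
    have hbad : (⋃ c ∈ {c | (q c = v ∧ d c = d v + 1) ∧ ∃ s ∈ S, s ∈ T c},
        {i | f i ∈ T c}).Finite := by
      refine Set.Finite.biUnion ?_ fun c hc => hfin c hc.1.1 hc.1.2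
      refine (hS.biUnion (t := fun s => {c | d c = d v + 1 ∧ s ∈ T c}) fun s _ => ?_).subset ?_
      · refine Set.Subsingleton.finite fun c hc c' hc' => ?_
        exact hTdisj c c' s (hc.1.trans hc'.1.symm) hc.2 hc'.2
      · rintro c ⟨⟨_, hd⟩, s, hs, hsc⟩
        exact Set.mem_biUnion hs ⟨hd, hsc⟩
    obtain ⟨i, hi, hi'⟩ := (hinf.sdiff (hbad.union hJ)).nonempty
    simp only [Set.mem_union, not_or] at hi'
    refine ⟨i, hi'.2, ?_⟩
    by_cases hiv : f i = v
    · rw [hiv]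
      exact JoinedIn.refl hvS
    · obtain ⟨c, hcv, hdc, hcr, hic⟩ := hTchild v (f i) hi hiv
      have hcS : ∀ s ∈ T c, s ∈ Sᶜ := fun s hs hsS =>
        hi'.1 (Set.mem_biUnion (x := c) ⟨⟨hcv, hdc⟩, s, hsS, hs⟩ hic)
      refine JoinedIn.trans (JoinedIn.of_adj ?_ hvS (hcS c (hTself c)))
        ((hTjoin c _ hic).mono hcS)
      exact hcv ▸ (hadj c hcr).symm
  · push Not at hstar
    choose! g hg hgd hginf using hstar
    have hseq : ∀ n, {i | f i ∈ T (g^[n] r)}.Infinite := fun n => by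
      induction n with
      | zero =>
        have : {i | f i ∈ T r} = Set.univ := Set.eq_univ_of_forall fun i => hTroot _
        simpa [this] using Set.infinite_univ
      | succ n ih =>
        rw [Function.iterate_succ_apply']
        exact hginf _ ih
    have hdn : ∀ n, d (g^[n] r) = n := fun n => by
      induction n with
      | zero => exact hq.depth_eq_zero r rfl
      | succ n ih => rw [Function.iterate_succ_apply', hgd _ (hseq n), ih]
    refine Or.inr ⟨⟨fun n => g^[n] r, fun m n hmn => ?_, fun n => ?_⟩, fun S hS J hJ => ?_⟩
    · rw [← hdn m, ← hdn n]
      exact congrArg d hmn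
    · have h₁ := hadj (g^[n + 1] r) (fun h => by
        have := hdn (n + 1)
        rw [hq.depth_eq_zero _ h] at this
        omega)
      rw [Function.iterate_succ_apply', hg _ (hseq n)] at h₁
      rw [Function.iterate_succ_apply']
      exact h₁.symm
    -- Beyond the largest depth occurring in `S`, whole subtrees avoid `S`.
    · obtain ⟨n, hn⟩ := (hS.image d).bddAbove
      obtain ⟨i, hi, hiJ⟩ := ((hseq (n + 1)).sdiff hJ).nonempty
      refine ⟨n + 1, i, hiJ, (hTjoin _ _ hi).mono fun s hs hsS => ?_⟩
      have h₁ := hs.1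
      rw [hdn] at h₁
      have h₂ := hn ⟨s, hsS, rfl⟩
      omega

/-! ### Boundaries and components -/

/-- The vertices outside `C` that have a neighbour in `C`. -/
def outerBoundary {V : Type u} (G : SimpleGraph V) (C : Set V) : Set V :=
  {y | y ∉ C ∧ ∃ x ∈ C, G.Adj x y}

/-- `D` is the vertex set of a component of the subgraph induced by `B`. -/
def IsComponentOf {V : Type u} (G : SimpleGraph V) (D B : Set V) : Prop :=
  ∃ a ∈ B, D = {b | G.JoinedIn B a b}

namespace IsComponentOf

variable {V : Type u} {G : SimpleGraph V} {B D D' : Set V}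

theorem subset (h : G.IsComponentOf D B) : D ⊆ B := by
  obtain ⟨a, ha, rfl⟩ := h
  exact fun b hb => hb.right_mem

theorem nonempty (h : G.IsComponentOf D B) : D.Nonempty := by
  obtain ⟨a, ha, rfl⟩ := h
  exact ⟨a, JoinedIn.refl ha⟩

theorem joinedIn (h : G.IsComponentOf D B) {x y : V} (hx : x ∈ D) (hy : y ∈ D) :
    G.JoinedIn D x y := by
  obtain ⟨a, ha, rfl⟩ := h
  exact (JoinedIn.joinedIn_component hx).symm.trans (JoinedIn.joinedIn_component hy)

theorem mem_of_joinedIn (h : G.IsComponentOf D B) {x y : V} (hx : x ∈ D)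
    (hxy : G.JoinedIn B x y) : y ∈ D := by
  obtain ⟨a, ha, rfl⟩ := h
  exact JoinedIn.trans hx hxy

theorem eq_of_mem (h : G.IsComponentOf D B) (h' : G.IsComponentOf D' B) {x : V} (hx : x ∈ D)
    (hx' : x ∈ D') : D = D' := by
  ext y
  exact ⟨fun hy => h'.mem_of_joinedIn hx' ((h.joinedIn hx hy).mono h.subset),
    fun hy => h.mem_of_joinedIn hx ((h'.joinedIn hx' hy).mono h'.subset)⟩

theorem disjoint_outerBoundary (h : G.IsComponentOf D B) {y : V} (hy : y ∈ G.outerBoundary D) :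
    y ∉ B := by
  obtain ⟨hyD, x, hx, hxy⟩ := hy
  exact fun hyB => hyD (h.mem_of_joinedIn hx (JoinedIn.of_adj hxy (h.subset hx) hyB))

end IsComponentOf

/-- A walk that avoids the outer boundary of `C` does not leave `C`. -/
theorem JoinedIn.mem_of_disjoint_outerBoundary {V : Type u} {G : SimpleGraph V} {B C : Set V}
    {a b : V} (h : G.JoinedIn B a b) (hC : ∀ y ∈ G.outerBoundary C, y ∉ B) (ha : a ∈ C) :
    b ∈ C :=
  h.mem_of_closed ha fun x hx y hy hxy => by
    by_contra hyC
    exact hC y ⟨hyC, x, hx, hxy⟩ hy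

/-- A ray either has a tail in a given set of finite boundary, or it has a tail outside. -/
theorem Ray.eventually_mem_or_notMem {V : Type u} {G : SimpleGraph V} (R : G.Ray) {C : Set V}
    (hC : (G.outerBoundary C).Finite) :
    (∃ N, ∀ n, N ≤ n → R.vertex n ∈ C) ∨ ∃ N, ∀ n, N ≤ n → R.vertex n ∉ C := by
  obtain ⟨N, hN⟩ := R.eventually_notMem hC
  by_cases h : ∃ n, N ≤ n ∧ R.vertex n ∈ C
  · obtain ⟨n, hn, hnC⟩ := h
    refine Or.inl ⟨n, fun m hm => ?_⟩
    exact (R.joinedIn (B := (G.outerBoundary C)ᶜ) hN hn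
      (hn.trans hm)).mem_of_disjoint_outerBoundary (fun y hy hy' => hy' hy) hnC
  · push Not at h
    exact Or.inr ⟨N, h⟩

theorem Ray.Equivalent.exists_joinedIn {V : Type u} {G : SimpleGraph V} {R R' : G.Ray}
    (h : R.Equivalent R') {S : Set V} (hS : S.Finite) :
    ∃ m n, G.JoinedIn Sᶜ (R.vertex m) (R'.vertex n) := by
  have h' := h S hS
  unfold Separates at h'
  push Not at h'
  obtain ⟨a, ⟨m, rfl⟩, b, ⟨n, rfl⟩, p, hp⟩ := h'
  exact ⟨m, n, p, hp⟩

theorem Ray.equivalent_of_joinedIn {V : Type u} {G : SimpleGraph V} {R R' : G.Ray}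
    (h : ∀ S : Set V, S.Finite → ∃ m n, G.JoinedIn Sᶜ (R.vertex m) (R'.vertex n)) :
    R.Equivalent R' := by
  intro S hS hsep
  obtain ⟨m, n, p, hp⟩ := h S hS
  obtain ⟨x, hx, hxS⟩ := hsep _ ⟨m, rfl⟩ _ ⟨n, rfl⟩ p
  exact hp x hx hxS

/-- A set of finite boundary that contains a tail of a ray contains a tail of every equivalent
ray. -/
theorem Ray.Equivalent.eventually_mem {V : Type u} {G : SimpleGraph V} {R R' : G.Ray}
    (h : R.Equivalent R') {C : Set V} (hC : (G.outerBoundary C).Finite)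
    (hR : ∃ N, ∀ n, N ≤ n → R.vertex n ∈ C) : ∃ N, ∀ n, N ≤ n → R'.vertex n ∈ C := by
  refine (R'.eventually_mem_or_notMem hC).resolve_right fun ⟨N', hN'⟩ => ?_
  obtain ⟨N, hN⟩ := hR
  -- Deleting the initial segments along with the boundary forces the connecting walk to start and
  -- end in the tails.
  obtain ⟨m, n, hmn⟩ := h.exists_joinedIn
    ((hC.union ((Set.finite_Iio N).image R.vertex)).union ((Set.finite_Iio N').image R'.vertex))
  have hm : N ≤ m := by
    by_contra hlt
    exact hmn.left_mem (Or.inl (Or.inr ⟨m, not_le.mp hlt, rfl⟩))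
  have hn : N' ≤ n := by
    by_contra hlt
    exact hmn.right_mem (Or.inr ⟨n, not_le.mp hlt, rfl⟩)
  refine hN' n hn (hmn.mem_of_disjoint_outerBoundary (fun y hy hy' => ?_) (hN m hm))
  exact hy' (Or.inl (Or.inl hy))

theorem Ray.equivalent_of_toEnd_eq {V : Type u} {G : SimpleGraph V} {R R' : G.Ray}
    (h : R.toEnd = R'.toEnd) : R.Equivalent R' :=
  Quotient.exact h

/-! ### Envelopes -/

/-- No finite set of vertices separates the ray `R` from `B`. -/
def Ray.Near {V : Type u} {G : SimpleGraph V} (R : G.Ray) (B : Set V) : Prop :=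
  ∀ S : Set V, S.Finite → ∃ n, ∃ b ∈ B, G.JoinedIn Sᶜ (R.vertex n) b

/-- No finite set of other vertices separates the vertex `v` from `B`. -/
def NearVertex {V : Type u} (G : SimpleGraph V) (B : Set V) (v : V) : Prop :=
  ∀ S : Set V, S.Finite → v ∉ S → ∃ b ∈ B, G.JoinedIn Sᶜ v b

/-- Every finite set of vertices separates only finitely many vertices of `B` from `A`. -/
def ClingsTo {V : Type u} (G : SimpleGraph V) (B A : Set V) : Prop :=
  ∀ S : Set V, S.Finite → ∃ E : Set V, E.Finite ∧
    ∀ b ∈ B, b ∉ S → b ∉ E → ∃ a ∈ A, G.JoinedIn Sᶜ b a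

/-- Deleting the finite exceptional set together with `S` forces the ray to reach a vertex of `B`
from which `A` is still accessible. -/
theorem Ray.Near.of_clingsTo {V : Type u} {G : SimpleGraph V} {R : G.Ray} {A B : Set V}
    (h : R.Near B) (hBA : G.ClingsTo B A) : R.Near A := by
  intro S hS
  obtain ⟨E, hE, hE'⟩ := hBA S hS
  obtain ⟨n, b, hb, hnb⟩ := h (S ∪ E) (hS.union hE)
  have hbSE := hnb.right_mem
  obtain ⟨a, ha, hba⟩ := hE' b hb (fun h => hbSE (Or.inl h)) fun h => hbSE (Or.inr h)
  exact ⟨n, a, ha, (hnb.mono fun x hx hxS => hx (Or.inl hxS)).trans hba⟩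

theorem NearVertex.of_clingsTo {V : Type u} {G : SimpleGraph V} {v : V} {A B : Set V}
    (h : G.NearVertex B v) (hv : v ∉ B) (hBA : G.ClingsTo B A) : G.NearVertex A v := by
  intro S hS hvS
  obtain ⟨E, hE, hE'⟩ := hBA S hS
  -- The vertex `v` might belong to `E` but not to `B`, so only `E ∩ B` may be deleted.
  obtain ⟨b, hb, hvb⟩ := h (S ∪ (E ∩ B)) (hS.union (hE.inter_of_left B))
    fun hv' => hv'.elim hvS fun h => hv h.2
  have hbSE := hvb.right_mem
  obtain ⟨a, ha, hba⟩ := hE' b hb (fun h => hbSE (Or.inl h)) fun h => hbSE (Or.inr ⟨h, hb⟩)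
  exact ⟨a, ha, (hvb.mono fun x hx hxS => hx (Or.inl hxS)).trans hba⟩

theorem clingsTo_union_nearVertex {V : Type u} (G : SimpleGraph V) (U : Set V) :
    G.ClingsTo (U ∪ {v | G.NearVertex U v}) U := by
  refine fun S hS => ⟨∅, Set.finite_empty, ?_⟩
  rintro b (hb | hb) hbS -
  · exact ⟨b, hb, JoinedIn.refl hbS⟩
  · exact hb S hS hbS

/-- The exceptions are the initial segments up to vertices of `S`; by disjointness each vertex of
`S` spoils only one ray, so they are finitely many. From any other vertex of a ray, the tail avoids
`S` and leads on to `U`. -/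
theorem clingsTo_union_rays {V : Type u} {G : SimpleGraph V} {U : Set V} {F : Set G.Ray}
    (hF : ∀ R ∈ F, R.Near U)
    (hdisj : ∀ R ∈ F, ∀ R' ∈ F, R ≠ R' → Disjoint R.verts R'.verts) :
    G.ClingsTo (U ∪ ⋃ R ∈ F, R.verts) U := by
  intro S hS
  refine ⟨⋃ s ∈ S, {b | ∃ R ∈ F, ∃ m n, n ≤ m ∧ R.vertex m = s ∧ R.vertex n = b},
    hS.biUnion fun s _ => ?_, ?_⟩
  · by_cases h : ∃ R ∈ F, ∃ m, R.vertex m = s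
    · obtain ⟨R, hR, m, rfl⟩ := h
      refine ((Set.finite_Iic m).image R.vertex).subset ?_
      rintro b ⟨R', hR', m', n, hn, hm', rfl⟩
      have hRR' : R' = R := by
        by_contra hne
        exact Set.disjoint_left.mp (hdisj R' hR' R hR hne) ⟨m', hm'⟩ ⟨m, rfl⟩
      subst hRR'
      have := R'.injective hm'
      exact ⟨n, Set.mem_Iic.mpr (by omega), rfl⟩
    · refine Set.finite_empty.subset ?_
      rintro b ⟨R, hR, m, n, -, hm, -⟩
      exact h ⟨R, hR, m, hm⟩
  · rintro b (hb | hb) hbS hbE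
    · exact ⟨b, hb, JoinedIn.refl hbS⟩
    · simp only [Set.mem_iUnion] at hb
      obtain ⟨R, hR, n, rfl⟩ := hb
      have htail : ∀ m, n ≤ m → R.vertex m ∈ Sᶜ := fun m hm hmS =>
        hbE (Set.mem_biUnion hmS ⟨R, hR, m, n, hm, rfl, rfl⟩)
      obtain ⟨m, a, ha, hma⟩ := hF R hR (S ∪ R.vertex '' Set.Iio n)
        (hS.union ((Set.finite_Iio n).image _))
      have hm : n ≤ m := by
        by_contra hlt
        exact hma.left_mem (Or.inr ⟨m, not_le.mp hlt, rfl⟩)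
      exact ⟨a, ha, (R.joinedIn htail le_rfl hm).trans
        (hma.mono fun x hx hxS => hx (Or.inl hxS))⟩

/-- The exceptions are the ancestors of `S`. If `z` is an ancestor of `w` but of no vertex of `S`,
the parent chain from `w` to `z` avoids `S`, since `z` is an ancestor of all its vertices. -/
theorem clingsTo_ancestors {V : Type u} {G : SimpleGraph V} {U B : Set V} {q : V → V} {d : V → ℕ}
    (hq : IsParentMap U q d) (hadj : ∀ v ∉ U, G.Adj v (q v)) :
    G.ClingsTo {z | ∃ w ∈ B, ∃ k, q^[k] w = z} B := by
  refine fun S hS => ⟨⋃ s ∈ S, {v | ∃ k, q^[k] s = v},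
    hS.biUnion fun s _ => hq.finite_ancestors s, ?_⟩
  rintro z ⟨w, hw, k, rfl⟩ hzS hzE
  refine ⟨w, hw, ((hq.joinedIn_iterate hadj w k).mono ?_).symm⟩
  rintro x ⟨j, hj, rfl⟩ hxS
  refine hzE (Set.mem_biUnion hxS ⟨k - j, ?_⟩)
  rw [← Function.iterate_add_apply]
  congr 2
  omega

/-- Among the rays that cannot be separated finitely from `U` there is a maximal disjoint family. -/
theorem exists_maximal_disjoint_rays {V : Type u} (G : SimpleGraph V) (U : Set V) :
    ∃ F : Set G.Ray, (∀ R ∈ F, R.Near U) ∧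
      (∀ R ∈ F, ∀ R' ∈ F, R ≠ R' → Disjoint R.verts R'.verts) ∧
      ∀ R : G.Ray, R.Near U → ∃ R' ∈ F, ¬ Disjoint R.verts R'.verts := by
  obtain ⟨F, hF⟩ := zorn_subset {F : Set G.Ray | (∀ R ∈ F, R.Near U) ∧
      ∀ R ∈ F, ∀ R' ∈ F, R ≠ R' → Disjoint R.verts R'.verts} (by
    intro c hc hchain
    refine ⟨⋃₀ c, ⟨fun R ⟨F, hFc, hR⟩ => (hc hFc).1 R hR, ?_⟩,
      fun F hF => Set.subset_sUnion_of_mem hF⟩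
    rintro R ⟨F, hFc, hR⟩ R' ⟨F', hFc', hR'⟩ hne
    rcases hchain.total hFc hFc' with h | h
    · exact (hc hFc').2 R (h hR) R' hR' hne
    · exact (hc hFc).2 R hR R' (h hR') hne)
  refine ⟨F, hF.prop.1, hF.prop.2, fun R hR => ?_⟩
  by_contra! hdisj
  -- A ray disjoint from all members would by maximality be a member, hence disjoint from itself.
  have hmem : R ∈ F := by
    refine hF.le_of_ge (y := insert R F) ⟨?_, ?_⟩ (Set.subset_insert R F) (Set.mem_insert R F)
    · rintro R' (rfl | hR')
      · exact hR
      · exact hF.prop.1 R' hR'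
    · rintro R₁ (rfl | h₁) R₂ (rfl | h₂) hne
      · exact absurd rfl hne
      · exact hdisj R₂ h₂
      · exact (hdisj R₁ h₁).symm
      · exact hF.prop.2 R₁ h₁ R₂ h₂ hne
  exact Set.disjoint_left.mp (hdisj R hmem) ⟨0, rfl⟩ ⟨0, rfl⟩

/-- If a component outside `Z` has infinitely many neighbours in `Z`, then it contains a vertex or
a ray that cannot be separated finitely from `Z`. -/
theorem IsComponentOf.exists_near {V : Type u} {G : SimpleGraph V} {Z D : Set V}
    (hD : G.IsComponentOf D Zᶜ) (hinf : (G.outerBoundary D).Infinite) :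
    (∃ v ∈ D, G.NearVertex Z v) ∨ ∃ R : G.Ray, R.verts ⊆ D ∧ R.Near Z := by
  have hconn : (G.induce D).Connected :=
    induce_connected_of_joinedIn hD.nonempty fun a ha b hb => hD.joinedIn ha hb
  have : Infinite (G.outerBoundary D) := hinf.to_subtype
  have hnb : ∀ y : G.outerBoundary D, ∃ x : D, G.Adj x y := fun y => by
    obtain ⟨x, hx, hxy⟩ := y.2.2
    exact ⟨⟨x, hx⟩, hxy⟩
  choose f hf using hnb
  have hZ : ∀ y : G.outerBoundary D, (y : V) ∈ Z := fun y =>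
    not_not.mp (hD.disjoint_outerBoundary y.2)
  -- The star-comb lemma is applied inside `D` to one chosen neighbour `f y` for each boundary
  -- vertex `y`. These may coincide, so the finite set of indices to avoid is taken from `S`, which
  -- keeps the final step to `y` outside `S`.
  have key : ∀ S : Set V, ∀ x : D, ∀ y : G.outerBoundary D, (y : V) ∉ S →
      (G.induce D).JoinedIn (Subtype.val ⁻¹' S)ᶜ x (f y) → G.JoinedIn Sᶜ x y := by
    intro S x y hyS hxy
    have h := hxy.of_induce.mono (B := Sᶜ) (by
      rintro _ ⟨z, hz, rfl⟩
      exact hz)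
    exact h.trans (JoinedIn.of_adj (hf y) h.right_mem hyS)
  rcases hconn.star_comb f with ⟨v, hv⟩ | ⟨R, hR⟩
  · refine Or.inl ⟨v, v.2, fun S hS hvS => ?_⟩
    obtain ⟨y, hyJ, hy⟩ := hv (Subtype.val ⁻¹' S) (hS.preimage Subtype.val_injective.injOn) hvS
      (Subtype.val ⁻¹' S) (hS.preimage Subtype.val_injective.injOn)
    exact ⟨y, hZ y, key S v y hyJ hy⟩
  · refine Or.inr ⟨⟨fun n => (R.vertex n : V), fun m n h => R.injective (Subtype.ext h),
      fun n => R.adj n⟩, ?_, fun S hS => ?_⟩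
    · rintro _ ⟨n, rfl⟩
      exact (R.vertex n).2
    · obtain ⟨n, y, hyJ, hy⟩ := hR (Subtype.val ⁻¹' S)
        (hS.preimage Subtype.val_injective.injOn)
        (Subtype.val ⁻¹' S) (hS.preimage Subtype.val_injective.injOn)
      exact ⟨n, y, hZ y, key S _ y hyJ hy⟩

/-- Every non-empty set `U` of vertices of a connected graph has an envelope: a larger set `Z` to
which no further rays cling, such that every component outside `Z` has only finitely many
neighbours, and from which one can descend to `U`. -/
theorem Connected.exists_envelope {V : Type u} {G : SimpleGraph V} (hG : G.Connected)
    {U : Set V} (hU : U.Nonempty) :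
    ∃ Z : Set V, U ⊆ Z ∧
      (∃ d : V → ℕ, ∀ z ∈ Z, z ∉ U → ∃ z' ∈ Z, G.Adj z z' ∧ d z' < d z) ∧
      (∀ D, G.IsComponentOf D Zᶜ → (G.outerBoundary D).Finite) ∧
      ∀ R : G.Ray, R.Near Z → R.Near U := by
  obtain ⟨F, hFnear, hFdisj, hFmax⟩ := exists_maximal_disjoint_rays G U
  obtain ⟨q, d, hq, hadj⟩ := hG.exists_parentMap hU
  -- Each stage clings to the one before. This carries nearness of rays from `Z` back to `U`, and
  -- nearness of vertices outside `Z` back to `U₁`.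
  set U₁ : Set V := U ∪ ⋃ R ∈ F, R.verts with hU₁
  set U₂ : Set V := U₁ ∪ {v | G.NearVertex U₁ v} with hU₂
  set Z : Set V := {z | ∃ w ∈ U₂, ∃ k, q^[k] w = z} with hZ
  have h₁ : G.ClingsTo U₁ U := clingsTo_union_rays hFnear hFdisj
  have h₂ : G.ClingsTo U₂ U₁ := clingsTo_union_nearVertex G U₁
  have h₃ : G.ClingsTo Z U₂ := clingsTo_ancestors hq hadj
  have hU₂Z : U₂ ⊆ Z := fun w hw => ⟨w, hw, 0, rfl⟩
  have hnear : ∀ R : G.Ray, R.Near Z → R.Near U := fun R hR =>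
    ((hR.of_clingsTo h₃).of_clingsTo h₂).of_clingsTo h₁
  refine ⟨Z, fun u hu => hU₂Z (Or.inl (Or.inl hu)), ⟨d, ?_⟩, fun D hD => ?_, hnear⟩
  · rintro z ⟨w, hw, k, rfl⟩ hzU
    refine ⟨q (q^[k] w), ⟨w, hw, k + 1, Function.iterate_succ_apply' q k w⟩, hadj _ hzU, ?_⟩
    have := hq.depth_parent _ hzU
    omega
  · by_contra hinf
    -- Such a vertex would have been added to `U₂`, and such a ray meets a ray of the maximal
    -- family, which lies in `Z`.
    rcases hD.exists_near hinf with ⟨v, hvD, hv⟩ | ⟨R, hRD, hR⟩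
    · have hvZ : v ∉ Z := hD.subset hvD
      have hv₂ : v ∉ U₂ := fun h => hvZ (hU₂Z h)
      have hv₁ := (hv.of_clingsTo hvZ h₃).of_clingsTo hv₂ h₂
      exact hv₂ (Or.inr hv₁)
    · obtain ⟨R', hR', hndisj⟩ := hFmax R (hnear R hR)
      refine hndisj (Set.disjoint_left.mpr fun x hx hx' => hD.subset (hRD hx) (hU₂Z ?_))
      exact Or.inl (Or.inr (Set.mem_biUnion hR' hx'))

/-! ### Dominating vertices -/

/-- The star is built greedily: each new path avoids all earlier ones except at the centre, which
must be left out of the deleted set. -/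
theorem dominates_of_forall_joinedIn {V : Type u} {G : SimpleGraph V} {R : G.Ray} {x : V}
    (h : ∀ S : Set V, S.Finite → x ∉ S → ∃ n, R.vertex n ≠ x ∧ G.JoinedIn Sᶜ x (R.vertex n)) :
    G.Dominates x R.toEnd := by
  classical
  obtain ⟨f, hf, hdisj⟩ := exists_seq_of_forall_finset_exists
    (α := Σ n, G.Walk x (R.vertex n)) (fun t => R.vertex t.1 ≠ x ∧ t.2.IsPath)
    (fun t t' => ∀ y, y ∈ t.2.support → y ∈ t'.2.support → y = x) (fun s _ => by
      obtain ⟨n, hn, p, hp⟩ := h ((⋃ t ∈ s, {y | y ∈ t.2.support}) \ {x})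
        ((s.finite_toSet.biUnion fun t _ => t.2.support.finite_toSet).sdiff) (fun hx => hx.2 rfl)
      refine ⟨⟨n, p.bypass⟩, ⟨hn, p.bypass_isPath⟩, fun t ht y hy hy' => ?_⟩
      by_contra hyx
      exact hp y (p.support_bypass_subset_support hy') ⟨Set.mem_biUnion ht hy, hyx⟩)
  refine ⟨⟨x, fun n => R.vertex (f n).1, fun n => (hf n).1, fun n => (f n).2,
    fun n => (hf n).2, fun m n hmn y hy hy' => ?_⟩, rfl, R, rfl, fun n => ⟨_, rfl⟩⟩
  rcases lt_or_gt_of_ne hmn with hlt | hlt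
  · exact hdisj m n hlt y hy hy'
  · exact hdisj n m hlt y hy' hy

/-- If a ray clings to the neighbourhood of a finite set of vertices, then its end is dominated by
one of them. -/
theorem Ray.Near.exists_dominates {V : Type u} {G : SimpleGraph V} {R : G.Ray} {X : Set V}
    (hX : X.Finite) (h : R.Near {c | ∃ x ∈ X, G.Adj x c}) : ∃ x ∈ X, G.Dominates x R.toEnd := by
  by_contra! hdom
  have hsep : ∀ x ∈ X, ∃ S : Set V, S.Finite ∧ x ∉ S ∧
      ∀ n, R.vertex n ≠ x → ¬ G.JoinedIn Sᶜ x (R.vertex n) := by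
    intro x hx
    by_contra! hx'
    exact hdom x hx (dominates_of_forall_joinedIn hx')
  choose! S hS hxS hS' using hsep
  -- If no vertex of `X` dominates, finitely many finite separators suffice for all of them at once;
  -- yet the ray still reaches a neighbour `c` of some `x`, and the edge from `x` to `c` bypasses `S
  -- x`.
  obtain ⟨n, c, ⟨x, hx, hxc⟩, hnc⟩ := h (X ∪ ⋃ x ∈ X, S x) (hX.union (hX.biUnion hS))
  have hsub : (X ∪ ⋃ x ∈ X, S x)ᶜ ⊆ (S x)ᶜ := fun y hy hyS =>
    hy (Or.inr (Set.mem_biUnion hx hyS))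
  refine hS' x hx n (fun hnx => hnc.left_mem (Or.inl (hnx ▸ hx))) ?_
  exact (JoinedIn.of_adj hxc (hxS x hx) (hsub hnc.right_mem)).trans (hnc.mono hsub).symm

/-! ### Regions and their parts -/

/-- A region is a non-empty connected set of vertices with finite boundary. -/
structure IsRegion {V : Type u} (G : SimpleGraph V) (C : Set V) : Prop where
  nonempty : C.Nonempty
  joinedIn : ∀ a ∈ C, ∀ b ∈ C, G.JoinedIn C a b
  finite_boundary : (G.outerBoundary C).Finite

/-- The conditions on the part `P` of a tree-decomposition that is placed in the region `C`; the
components of `C` outside `P` are the regions of the next level. -/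
structure IsPartOf {V : Type u} (G : SimpleGraph V) (C P : Set V) : Prop where
  subset : P ⊆ C ∪ G.outerBoundary C
  boundary_subset : G.outerBoundary C ⊆ P
  inter_nonempty : (P ∩ C).Nonempty
  joinedIn : ∀ a ∈ P, ∀ b ∈ P, G.JoinedIn P a b
  finite_boundary : ∀ D, G.IsComponentOf D (C \ P) → (G.outerBoundary D).Finite
  disjoint_boundary : ∀ D, G.IsComponentOf D (C \ P) →
    Disjoint (G.outerBoundary C) (G.outerBoundary D)
  exists_component : ∀ R : G.Ray, R.toEnd ∈ G.topologicalEnds →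
    (∃ N, ∀ n, N ≤ n → R.vertex n ∈ C) →
      ∃ D, G.IsComponentOf D (C \ P) ∧ ∃ N, ∀ n, N ≤ n → R.vertex n ∈ D

/-- Finitely many vertices in a connected set lie in a finite connected subset. -/
theorem exists_finite_joinedIn {V : Type u} {G : SimpleGraph V} {B X : Set V} {c : V}
    (hc : c ∈ B) (hX : X.Finite) (h : ∀ x ∈ X, G.JoinedIn B c x) :
    ∃ F ⊆ B, F.Finite ∧ c ∈ F ∧ X ⊆ F ∧ ∀ y ∈ F, G.JoinedIn F c y := by
  have hex : ∀ x ∈ X, ∃ A ⊆ B, A.Finite ∧ G.JoinedIn A c x := by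
    intro x hx
    obtain ⟨p, hp⟩ := h x hx
    exact ⟨{y | y ∈ p.support}, hp, p.support.finite_toSet, p, fun y hy => hy⟩
  choose! A hAB hA hAx using hex
  have hsub : ∀ x ∈ X, {y | G.JoinedIn (A x) c y} ⊆ A x := fun x _ y hy => hy.right_mem
  refine ⟨insert c (⋃ x ∈ X, {y | G.JoinedIn (A x) c y}), ?_, ?_, Set.mem_insert _ _, ?_, ?_⟩
  · refine Set.insert_subset hc (Set.iUnion₂_subset fun x hx => (hsub x hx).trans (hAB x hx))
  · exact (hX.biUnion fun x hx => (hA x hx).subset (hsub x hx)).insert c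
  · exact fun x hx => Set.mem_insert_of_mem _ (Set.mem_biUnion hx (hAx x hx))
  · rintro y (rfl | hy)
    · exact JoinedIn.refl (Set.mem_insert _ _)
    · obtain ⟨x, hx, hy⟩ := Set.mem_iUnion₂.mp hy
      exact (JoinedIn.joinedIn_component hy).mono fun z hz =>
        Set.mem_insert_of_mem _ (Set.mem_biUnion hx hz)

/-- The part is the trace on `C ∪ X` of an envelope of `U`. The finite set `F` puts `X` into the
part and connects it; the neighbours of `X` in `C` are included so that the remaining components do
not touch `X`. -/
theorem IsRegion.exists_isPartOf {V : Type u} {G : SimpleGraph V} (hG : G.Connected) {C : Set V}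
    (hC : G.IsRegion C) : ∃ P, G.IsPartOf C P := by
  obtain ⟨c, hc⟩ := hC.nonempty
  set X := G.outerBoundary C with hXdef
  have hX : X.Finite := hC.finite_boundary
  obtain ⟨F, hFB, hF, hcF, hXF, hFjoin⟩ := exists_finite_joinedIn (B := C ∪ X) (Or.inl hc) hX
    (fun x hx => by
      obtain ⟨-, y, hy, hyx⟩ := id hx
      exact ((hC.joinedIn c hc y hy).mono Set.subset_union_left).trans
        (JoinedIn.of_adj hyx (Or.inl hy) (Or.inr hx)))
  set N : Set V := {y | ∃ x ∈ X, G.Adj x y} with hN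
  set U : Set V := F ∪ (C ∩ N) with hU
  obtain ⟨Z, hUZ, ⟨d, hd⟩, hfin, hnear⟩ := hG.exists_envelope (U := U) ⟨c, Or.inl hcF⟩
  have hUB : U ⊆ C ∪ X := Set.union_subset hFB fun y hy => Or.inl hy.1
  have hUP : U ⊆ Z ∩ (C ∪ X) := fun y hy => ⟨hUZ hy, hUB hy⟩
  have hXZ : X ⊆ Z := fun x hx => hUZ (Or.inl (hXF hx))
  have hUjoin : ∀ y ∈ U, G.JoinedIn U c y := by
    have hF' : ∀ y ∈ F, G.JoinedIn U c y := fun y hy => (hFjoin y hy).mono Set.subset_union_left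
    rintro y (hy | hy)
    · exact hF' y hy
    · obtain ⟨x, hx, hxy⟩ := hy.2
      exact (hF' x (hXF hx)).trans (JoinedIn.of_adj hxy (Or.inl (hXF hx)) (Or.inr hy))
  -- Descent from `z` to `U` cannot leave `C ∪ X`: vertices outside `U` lie in `C`, so their
  -- neighbours lie in `C` or in `X`.
  have hPjoin : ∀ n, ∀ z ∈ Z ∩ (C ∪ X), d z = n → G.JoinedIn (Z ∩ (C ∪ X)) c z := by
    intro n
    induction n using Nat.strong_induction_on with
    | _ n ih =>
      intro z hz hdz
      by_cases hzU : z ∈ U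
      · exact (hUjoin z hzU).mono hUP
      · obtain ⟨y, hyZ, hzy, hdy⟩ := hd z hz.1 hzU
        have hzC : z ∈ C := hz.2.resolve_right fun h => hzU (Or.inl (hXF h))
        have hy : y ∈ Z ∩ (C ∪ X) := by
          refine ⟨hyZ, ?_⟩
          by_cases hyC : y ∈ C
          · exact Or.inl hyC
          · exact Or.inr ⟨hyC, z, hzC, hzy⟩
        exact (ih (d y) (hdz ▸ hdy) y hy rfl).trans (JoinedIn.of_adj hzy.symm hy hz)
  have hdiff : C \ (Z ∩ (C ∪ X)) = C \ Z := by
    ext y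
    simp only [Set.mem_sdiff, Set.mem_inter_iff, Set.mem_union]
    tauto
  -- Since `X ⊆ Z`, a walk outside `Z` that starts in `C` stays in `C`.
  have hcomp : ∀ D, G.IsComponentOf D (C \ Z) → G.IsComponentOf D Zᶜ := by
    rintro D ⟨a, ha, rfl⟩
    refine ⟨a, ha.2, Set.ext fun b => ⟨fun hb => JoinedIn.mono hb fun y hy => hy.2, fun hb => ?_⟩⟩
    refine (JoinedIn.joinedIn_component hb).mono fun y hy => ?_
    exact ⟨JoinedIn.mem_of_disjoint_outerBoundary hy (fun x hx hx' => hx' (hXZ hx)) ha.1,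
      hy.right_mem⟩
  refine ⟨Z ∩ (C ∪ X), Set.inter_subset_right, fun x hx => ⟨hXZ hx, Or.inr hx⟩,
    ⟨c, hUP (Or.inl hcF), hc⟩,
    fun a ha b hb => (hPjoin _ a ha rfl).symm.trans (hPjoin _ b hb rfl), ?_, ?_, ?_⟩
  · rw [hdiff]
    exact fun D hD => hfin D (hcomp D hD)
  · rw [hdiff]
    intro D hD
    rw [Set.disjoint_left]
    rintro x hx ⟨-, y, hy, hyx⟩
    -- A vertex of `D` adjacent to `X` would be one of the neighbours put into `U`.
    exact (hD.subset hy).2 (hUZ (Or.inr ⟨(hD.subset hy).1, x, hx, hyx.symm⟩))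
  · rw [hdiff]
    intro R hR hRC
    have hnot : ¬ R.Near Z := fun h => by
      -- Apart from the finite set `F`, all of `U` consists of neighbours of `X`, so clinging to `U`
      -- means clinging to `N`.
      have hNU : G.ClingsTo U N := fun S hS => ⟨F, hF, fun b hb hbS hbF =>
        ⟨b, (hb.resolve_left hbF).2, JoinedIn.refl hbS⟩⟩
      obtain ⟨x, -, hx⟩ := ((hnear R h).of_clingsTo hNU).exists_dominates hX
      exact hR ⟨x, hx⟩
    simp only [Ray.Near] at hnot
    push Not at hnot
    obtain ⟨S, hS, hSZ⟩ := hnot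
    obtain ⟨N₁, h₁⟩ := R.eventually_notMem hS
    obtain ⟨N₂, h₂⟩ := hRC
    have htail : ∀ k, max N₁ N₂ ≤ k → R.vertex k ∈ C \ Z := fun k hk =>
      ⟨h₂ k (le_of_max_le_right hk), fun hZ =>
        hSZ k _ hZ (JoinedIn.refl (h₁ k (le_of_max_le_left hk)))⟩
    exact ⟨_, ⟨R.vertex (max N₁ N₂), htail _ le_rfl, rfl⟩, max N₁ N₂,
      fun n hn => R.joinedIn htail le_rfl hn⟩

/-! ### Rooted trees given by parent functions -/

/-- The graph in which every vertex is adjacent to its parent. -/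
def parentGraph {W : Type v} (q : W → W) : SimpleGraph W where
  Adj x y := x ≠ y ∧ (q x = y ∨ q y = x)
  symm := ⟨fun _ _ h => ⟨h.1.symm, h.2.symm⟩⟩
  loopless := ⟨fun _ h => h.1 rfl⟩

namespace IsParentMap

variable {W : Type v} {r : W} {q : W → W} {d : W → ℕ}

theorem parent_ne (h : IsParentMap {r} q d) {w : W} (hw : w ≠ r) : q w ≠ w := fun heq => by
  have := h.depth_parent w hw
  rw [heq] at this
  omega

theorem parentGraph_adj (h : IsParentMap {r} q d) {w : W} (hw : w ≠ r) :
    (parentGraph q).Adj w (q w) :=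
  ⟨(h.parent_ne hw).symm, Or.inl rfl⟩

theorem ne_root_of_parent_ne (h : IsParentMap {r} q d) {w : W} (hw : q w ≠ w) : w ≠ r :=
  fun heq => hw (h.fixed w heq)

/-- The descendants of `x`. -/
def descendants (q : W → W) (x : W) : Set W := {w | ∃ k, q^[k] w = x}

theorem mem_descendants_of_parent {x w : W} (hw : q w ∈ descendants q x) :
    w ∈ descendants q x := by
  obtain ⟨k, hk⟩ := hw
  exact ⟨k + 1, by rwa [Function.iterate_succ_apply]⟩

theorem parent_mem_descendants {x w : W} (hw : w ∈ descendants q x) (hne : w ≠ x) :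
    q w ∈ descendants q x := by
  obtain ⟨k, hk⟩ := hw
  rcases k with _ | k
  · exact absurd hk hne
  · exact ⟨k, by rwa [Function.iterate_succ_apply] at hk⟩

theorem depth_le (h : IsParentMap {r} q d) {x w : W} (hw : w ∈ descendants q x) : d x ≤ d w := by
  obtain ⟨k, rfl⟩ := hw
  rw [h.depth_iterate]
  omega

theorem parent_notMem_descendants (h : IsParentMap {r} q d) {x : W} (hx : x ≠ r) :
    q x ∉ descendants q x := fun hmem => by
  have h₁ := h.depth_le hmem
  have h₂ := h.depth_parent x hx
  omega

/-- The only edge between the descendants of `x` and the other vertices joins `x` to its parent. -/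
theorem eq_of_adj {x w w' : W} (hw : w ∈ descendants q x)
    (hw' : w' ∉ descendants q x) (hadj : (parentGraph q).Adj w w') : w = x ∧ w' = q x := by
  rcases hadj.2 with heq | heq
  · by_cases hwx : w = x
    · exact ⟨hwx, by rw [← heq, hwx]⟩
    · exact absurd (heq ▸ parent_mem_descendants hw hwx) hw'
  · exact absurd (mem_descendants_of_parent (heq ▸ hw)) hw'

theorem outerBoundary_descendants_subset (x : W) :
    (parentGraph q).outerBoundary (descendants q x) ⊆ {q x} := by
  rintro w' ⟨hw', w, hw, hadj⟩
  exact (eq_of_adj hw hw' hadj).2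

theorem mem_of_reachable_deleteEdges {x w w' : W}
    (hr : ((parentGraph q).deleteEdges {s(x, q x)}).Reachable w w')
    (hw : w ∈ descendants q x) : w' ∈ descendants q x := by
  obtain ⟨p⟩ := hr
  induction p with
  | nil => exact hw
  | cons hadj p ih =>
    refine ih ?_
    by_contra hv
    rw [deleteEdges_adj] at hadj
    obtain ⟨rfl, rfl⟩ := eq_of_adj hw hv hadj.1
    exact hadj.2 rfl

theorem reachable_root (h : IsParentMap {r} q d) (w : W) : (parentGraph q).Reachable w r := by
  obtain ⟨p, -⟩ := h.joinedIn_iterate (G := parentGraph q) (fun w hw => h.parentGraph_adj hw) w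
    (d w)
  have hr : q^[d w] w = r := h.iterate_depth_mem w
  exact ⟨p.copy rfl hr⟩

/-- Every edge is a bridge: once the edge from `x` to its parent is deleted, only descendants of `x`
remain reachable from `x`. -/
theorem parentGraph_isTree (h : IsParentMap {r} q d) : (parentGraph q).IsTree := by
  refine ⟨?_, isAcyclic_iff_forall_adj_isBridge.mpr ?_⟩
  · exact (connected_iff_exists_forall_reachable _).mpr
      ⟨r, fun w => (h.reachable_root w).symm⟩
  · have key : ∀ x, q x ≠ x → (parentGraph q).IsBridge s(x, q x) := fun x hx => by
      rw [isBridge_iff]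
      exact fun hr => h.parent_notMem_descendants (h.ne_root_of_parent_ne hx)
        (mem_of_reachable_deleteEdges hr ⟨0, rfl⟩)
    rintro x y ⟨hne, rfl | rfl⟩
    · exact key x hne.symm
    · rw [Sym2.eq_swap]
      exact key y hne

theorem reachable_deleteEdges_of_mem (h : IsParentMap {r} q d) {x w : W} (hx : x ≠ r)
    (hw : w ∈ descendants q x) :
    ((parentGraph q).deleteEdges {s(x, q x)}).Reachable x w := by
  obtain ⟨k, hk⟩ := hw
  induction k generalizing w with
  | zero => exact hk ▸ Reachable.refl _
  | succ k ih =>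
    rw [Function.iterate_succ_apply] at hk
    by_cases hwx : w = x
    · exact hwx ▸ Reachable.refl _
    by_cases hwr : w = r
    · exact ih (by rwa [h.fixed w hwr] at hk)
    refine (ih hk).trans (Adj.reachable ?_)
    rw [deleteEdges_adj]
    refine ⟨(h.parentGraph_adj hwr).symm, fun heq => ?_⟩
    rcases Sym2.eq_iff.mp (Set.mem_singleton_iff.mp heq) with ⟨h₁, h₂⟩ | ⟨-, h₂⟩
    · have h₃ := h.depth_parent x hx
      have h₄ := h.depth_parent w hwr
      rw [h₁] at h₄
      rw [← h₂] at h₃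
      omega
    · exact hwx h₂

theorem reachable_deleteEdges_of_notMem (h : IsParentMap {r} q d) {x w : W}
    (hw : w ∉ descendants q x) :
    ((parentGraph q).deleteEdges {s(x, q x)}).Reachable w r := by
  have key : ∀ n, ∀ w, d w = n → w ∉ descendants q x →
      ((parentGraph q).deleteEdges {s(x, q x)}).Reachable w r := by
    intro n
    induction n with
    | zero =>
      intro w hd _
      have : w = r := h.mem_of_depth_eq_zero hd
      exact this ▸ Reachable.refl _
    | succ n ih =>
      intro w hd hw
      by_cases hwr : w = r
      · exact hwr ▸ Reachable.refl _
      have hqw : q w ∉ descendants q x := fun hq => hw (mem_descendants_of_parent hq)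
      have hdq := h.depth_parent w hwr
      refine Reachable.trans (Adj.reachable ?_) (ih (q w) (by omega) hqw)
      rw [deleteEdges_adj]
      refine ⟨h.parentGraph_adj hwr, fun heq => ?_⟩
      rcases Sym2.eq_iff.mp (Set.mem_singleton_iff.mp heq) with ⟨h₁, -⟩ | ⟨-, h₂⟩
      · exact hw ⟨0, h₁⟩
      · exact hqw ⟨0, h₂⟩
  exact key _ w rfl hw

theorem sideOf_child (h : IsParentMap {r} q d) {x : W} (hx : x ≠ r) :
    (parentGraph q).sideOf (q x) x = descendants q x := by
  ext w
  have hsw : s(q x, x) = s(x, q x) := Sym2.eq_swap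
  simp only [sideOf, hsw, Set.mem_ofPred_eq]
  exact ⟨fun hr => mem_of_reachable_deleteEdges hr ⟨0, rfl⟩,
    h.reachable_deleteEdges_of_mem hx⟩

theorem sideOf_parent (h : IsParentMap {r} q d) {x : W} (hx : x ≠ r) :
    (parentGraph q).sideOf x (q x) = (descendants q x)ᶜ := by
  ext w
  simp only [sideOf, Set.mem_ofPred_eq, Set.mem_compl_iff]
  have hqx := h.parent_notMem_descendants hx
  exact ⟨fun hr hw => hqx (mem_of_reachable_deleteEdges hr.symm hw),
    fun hw => (h.reachable_deleteEdges_of_notMem hqx).trans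
      (h.reachable_deleteEdges_of_notMem hw).symm⟩

/-- Paths in a tree are unique, so the path from the root to `y` is contained in the reversed parent
chain of `y`. -/
theorem mem_descendants_of_treeLE (h : IsParentMap {r} q d) {x y : W}
    (hxy : (parentGraph q).TreeLE r x y) : y ∈ descendants q x := by
  classical
  obtain ⟨p, hp, hx⟩ := hxy
  obtain ⟨p', hp'⟩ := h.joinedIn_iterate (G := parentGraph q)
    (fun w hw => h.parentGraph_adj hw) y (d y)
  have hr : q^[d y] y = r := h.iterate_depth_mem y
  set w := (p'.copy rfl hr).reverse
  have hsub : Subsingleton ((parentGraph q).Path r y) :=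
    h.parentGraph_isTree.isAcyclic.subsingleton_path r y
  have heq : p = w.bypass :=
    congrArg Subtype.val (hsub.elim ⟨p, hp⟩ ⟨w.bypass, w.bypass_isPath⟩)
  rw [heq] at hx
  have hx' := w.support_bypass_subset_support hx
  simp only [w, Walk.support_reverse, List.mem_reverse, Walk.support_copy] at hx'
  obtain ⟨j, -, hj⟩ := hp' x hx'
  exact ⟨j, hj⟩

theorem parent_eq_of_treeLE (h : IsParentMap {r} q d) {x y : W} (hadj : (parentGraph q).Adj x y)
    (hxy : (parentGraph q).TreeLE r x y) : q y = x := by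
  rcases hadj.2 with heq | heq
  · have h₁ := h.depth_le (h.mem_descendants_of_treeLE hxy)
    have h₂ := h.depth_parent x (h.ne_root_of_parent_ne (heq ▸ hadj.1.symm))
    rw [heq] at h₂
    omega
  · exact heq

/-- From some point on, every step on a ray leads from a vertex to one of its children. -/
theorem exists_ascending (h : IsParentMap {r} q d) (R : (parentGraph q).Ray) :
    ∃ N, ∀ n, N ≤ n → q (R.vertex (n + 1)) = R.vertex n := by
  have hup : ∃ N, q (R.vertex (N + 1)) = R.vertex N := by
    by_contra! hdown
    have hstep : ∀ n, d (R.vertex (n + 1)) + 1 = d (R.vertex n) := fun n => by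
      have heq : q (R.vertex n) = R.vertex (n + 1) := (R.adj n).2.resolve_right (hdown n)
      rw [← heq]
      exact h.depth_parent _ (h.ne_root_of_parent_ne (heq ▸ (R.adj n).1.symm))
    have hsum : ∀ n, d (R.vertex n) + n = d (R.vertex 0) := fun n => by
      induction n with
      | zero => rfl
      | succ n ih =>
        have := hstep n
        omega
    have := hsum (d (R.vertex 0) + 1)
    omega
  obtain ⟨N, hN⟩ := hup
  refine ⟨N, fun n hn => ?_⟩
  induction n, hn using Nat.le_induction with
  | base => exact hN
  | succ n _ ih =>
    -- Stepping back to the parent right after a step to a child would repeat a vertex.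
    refine (R.adj (n + 1)).2.resolve_left fun heq => ?_
    have := R.injective (ih.symm.trans heq)
    omega

/-- The path between two adjacent vertices or between two children of a vertex. -/
theorem eq_or_of_mem_path (h : IsParentMap {r} q d) {m x y z : W} (hx : x = m ∨ q x = m)
    (hy : y = m ∨ q y = m) (p : (parentGraph q).Walk x y) (hp : p.IsPath) (hz : z ∈ p.support) :
    z = x ∨ z = y ∨ z = m := by
  classical
  have key : ∀ x, x = m ∨ q x = m → (parentGraph q).JoinedIn {z | z = x ∨ z = m} x m := by
    intro x hx
    by_cases hxm : x = m
    · exact hxm ▸ JoinedIn.refl (Or.inl rfl)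
    · have hq := hx.resolve_left hxm
      exact JoinedIn.of_adj ⟨hxm, Or.inl hq⟩ (Or.inl rfl) (Or.inr rfl)
  have hjoin : (parentGraph q).JoinedIn {z | z = x ∨ z = y ∨ z = m} x y :=
    ((key x hx).mono fun z hz => hz.imp_right Or.inr).trans
      ((key y hy).mono fun z hz => Or.inr hz).symm
  obtain ⟨w, hw⟩ := hjoin
  have hsub : Subsingleton ((parentGraph q).Path x y) :=
    h.parentGraph_isTree.isAcyclic.subsingleton_path x y
  have heq : p = w.bypass :=
    congrArg Subtype.val (hsub.elim ⟨p, hp⟩ ⟨w.bypass, w.bypass_isPath⟩)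
  rw [heq] at hz
  exact hw z (w.support_bypass_subset_support hz)

end IsParentMap

/-! ### The tree of regions -/

/-- The last region of a descending sequence of regions, listed backwards. -/
def lastRegion {V : Type u} : List (Set V) → Set V
  -- The empty list is the root, whose region is the whole vertex set.
  | [] => Set.univ
  | C :: _ => C

/-- A list of sets, read backwards, in which every set is a component of the previous one outside
its part. -/
def IsRegionList {V : Type u} (G : SimpleGraph V) (P : Set V → Set V) : List (Set V) → Prop
  | [] => True
  | C :: l => G.IsRegionList P l ∧ G.IsComponentOf C (lastRegion l \ P (lastRegion l))

/-- The nodes of the tree of regions. -/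
abbrev RegionNode {V : Type u} (G : SimpleGraph V) (P : Set V → Set V) : Type u :=
  {l : List (Set V) // G.IsRegionList P l}

namespace RegionNode

variable {V : Type u} {G : SimpleGraph V} {P : Set V → Set V}

/-- The region of a node. -/
def region (t : G.RegionNode P) : Set V := lastRegion t.1

/-- The part of the region of a node. -/
def part (t : G.RegionNode P) : Set V := P t.region

/-- The root. -/
def root (G : SimpleGraph V) (P : Set V → Set V) : G.RegionNode P := ⟨[], trivial⟩

/-- The parent of a node. -/
def parent : G.RegionNode P → G.RegionNode P
  | ⟨[], h⟩ => ⟨[], h⟩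
  | ⟨_ :: l, h⟩ => ⟨l, h.1⟩

/-- The depth of a node. -/
def depth (t : G.RegionNode P) : ℕ := t.1.length

theorem isParentMap (G : SimpleGraph V) (P : Set V → Set V) :
    IsParentMap {root G P} (parent (G := G) (P := P)) depth where
  depth_eq_zero := by
    rintro _ rfl
    rfl
  fixed := by
    rintro _ rfl
    rfl
  depth_parent := by
    rintro ⟨_ | ⟨C, l⟩, h⟩ hne
    · exact absurd rfl hne
    · rfl

theorem region_isComponentOf {t : G.RegionNode P} (ht : t ≠ root G P) :
    G.IsComponentOf t.region (t.parent.region \ t.parent.part) := by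
  obtain ⟨_ | ⟨C, l⟩, h⟩ := t
  · exact absurd rfl ht
  · exact h.2

theorem exists_child {t : G.RegionNode P} {D : Set V}
    (hD : G.IsComponentOf D (t.region \ t.part)) :
    ∃ s : G.RegionNode P, s ≠ root G P ∧ s.parent = t ∧ s.region = D :=
  ⟨⟨D :: t.1, t.2, hD⟩, fun h => List.cons_ne_nil _ _ (congrArg Subtype.val h), rfl, rfl⟩

theorem outerBoundary_root : G.outerBoundary (root G P).region = ∅ :=
  Set.eq_empty_of_forall_notMem fun _ hy => hy.1 trivial

theorem ext_of_parent_eq {s t : G.RegionNode P} (hs : s ≠ root G P) (ht : t ≠ root G P)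
    (hp : s.parent = t.parent) (hr : s.region = t.region) : s = t := by
  obtain ⟨_ | ⟨C, l⟩, h⟩ := s
  · exact absurd rfl hs
  obtain ⟨_ | ⟨C', l'⟩, h'⟩ := t
  · exact absurd rfl ht
  have h₁ : l = l' := congrArg Subtype.val hp
  have h₂ : C = C' := hr
  subst h₁ h₂
  rfl

theorem isRegion (hG : G.Connected) (hP : ∀ C, G.IsRegion C → G.IsPartOf C (P C))
    (t : G.RegionNode P) : G.IsRegion t.region := by
  obtain ⟨l, h⟩ := t
  induction l with
  | nil =>
    refine ⟨?_, fun a _ b _ => hG.joinedIn_univ a b, ?_⟩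
    · obtain ⟨v⟩ := hG.nonempty
      exact ⟨v, trivial⟩
    · exact Set.finite_empty.subset fun y hy => hy.1 trivial
  | cons C l ih =>
    exact ⟨h.2.nonempty, fun a ha b hb => h.2.joinedIn ha hb,
      (hP _ (ih h.1)).finite_boundary _ h.2⟩

theorem region_subset_parent (t : G.RegionNode P) : t.region ⊆ t.parent.region := by
  by_cases ht : t = root G P
  · rw [ht]
    exact fun _ _ => trivial
  · exact fun x hx => ((region_isComponentOf ht).subset hx).1

theorem notMem_part_parent {t : G.RegionNode P} (ht : t ≠ root G P) {x : V} (hx : x ∈ t.region) :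
    x ∉ t.parent.part :=
  ((region_isComponentOf ht).subset hx).2

theorem region_subset_iterate (t : G.RegionNode P) (k : ℕ) : t.region ⊆ (parent^[k] t).region := by
  induction k with
  | zero => exact subset_rfl
  | succ k ih =>
    rw [Function.iterate_succ_apply']
    exact ih.trans (region_subset_parent _)

theorem region_anti {s t : G.RegionNode P} (h : t ∈ IsParentMap.descendants parent s) :
    t.region ⊆ s.region := by
  obtain ⟨k, rfl⟩ := h
  exact region_subset_iterate t k

/-- By induction on the depth, regions of one level are disjoint: the parents share the vertex and
so coincide, and distinct components of the same set are disjoint. -/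
theorem eq_of_mem_region {s t : G.RegionNode P} {x : V} (hs : x ∈ s.region) (ht : x ∈ t.region)
    (hd : s.depth = t.depth) : s = t := by
  have hpm := isParentMap G P
  have key : ∀ n, ∀ s t : G.RegionNode P, x ∈ s.region → x ∈ t.region → s.depth = n →
      t.depth = n → s = t := by
    intro n
    induction n with
    | zero =>
      intro s t _ _ hs ht
      have h₁ := hpm.mem_of_depth_eq_zero hs
      have h₂ := hpm.mem_of_depth_eq_zero ht
      exact h₁.trans h₂.symm
    | succ n ih =>
      intro s t hxs hxt hs ht
      have hs' : s ≠ root G P := fun h => by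
        rw [hpm.depth_eq_zero s h] at hs
        omega
      have ht' : t ≠ root G P := fun h => by
        rw [hpm.depth_eq_zero t h] at ht
        omega
      have hds := hpm.depth_parent s hs'
      have hdt := hpm.depth_parent t ht'
      have hp : s.parent = t.parent := ih _ _ (region_subset_parent s hxs)
        (region_subset_parent t hxt) (by omega) (by omega)
      refine ext_of_parent_eq hs' ht' hp ?_
      have hcs := region_isComponentOf hs'
      rw [hp] at hcs
      exact hcs.eq_of_mem (region_isComponentOf ht') hxs hxt
  exact key _ s t hs ht rfl hd.symm

theorem mem_descendants_of_mem_region {s t : G.RegionNode P} {x : V} (hs : x ∈ s.region)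
    (ht : x ∈ t.region) (hd : s.depth ≤ t.depth) : t ∈ IsParentMap.descendants parent s := by
  refine ⟨t.depth - s.depth, eq_of_mem_region (region_subset_iterate t _ ht) hs ?_⟩
  rw [(isParentMap G P).depth_iterate]
  omega

/-- A vertex in the part and in the region of `m` lies only in the regions of `m` and of its
ancestors. -/
theorem mem_descendants_of_mem_part {m t : G.RegionNode P} {x : V} (hm : x ∈ m.region)
    (hmp : x ∈ m.part) (ht : x ∈ t.region) : m ∈ IsParentMap.descendants parent t := by
  have hpm := isParentMap G P
  refine mem_descendants_of_mem_region ht hm ?_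
  by_contra! hlt
  -- This is the ancestor of `t` one level beyond `m`. It would be a child of `m` whose region meets
  -- the part of `m`.
  set s := parent^[t.depth - m.depth - 1] t with hs
  have hsd : s.depth = m.depth + 1 := by
    rw [hs, hpm.depth_iterate]
    omega
  have hxs : x ∈ s.region := region_subset_iterate t _ ht
  have hsr : s ≠ root G P := fun h => by
    rw [hpm.depth_eq_zero s h] at hsd
    omega
  have hsm : s.parent = m := eq_of_mem_region (region_subset_parent s hxs) hm (by
    have := hpm.depth_parent s hsr
    omega)
  exact notMem_part_parent hsr hxs (hsm ▸ hmp)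

theorem isPartOf (hG : G.Connected) (hP : ∀ C, G.IsRegion C → G.IsPartOf C (P C))
    (t : G.RegionNode P) : G.IsPartOf t.region t.part :=
  hP _ (t.isRegion hG hP)

/-- A neighbour of a component that lies in the parent region but not in the component belongs to
the parent's part; one outside the parent region lies on the boundary of that region, which the part
contains. -/
theorem outerBoundary_subset_part_parent (hG : G.Connected)
    (hP : ∀ C, G.IsRegion C → G.IsPartOf C (P C)) (t : G.RegionNode P) :
    G.outerBoundary t.region ⊆ t.parent.part := by
  by_cases ht : t = root G P
  · rw [ht, outerBoundary_root]
    exact Set.empty_subset _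
  rintro y hy
  have hyB := (region_isComponentOf ht).disjoint_outerBoundary hy
  obtain ⟨-, x, hx, hxy⟩ := hy
  by_cases hyC : y ∈ t.parent.region
  · by_contra hyP
    exact hyB ⟨hyC, hyP⟩
  · exact (t.parent.isPartOf hG hP).boundary_subset ⟨hyC, x, region_subset_parent t hx, hxy⟩

/-- This is where disjointness of consecutive boundaries enters. It underlies both the bound on
depths and the upwards disjointness of separators. -/
theorem outerBoundary_subset_region_parent (hG : G.Connected)
    (hP : ∀ C, G.IsRegion C → G.IsPartOf C (P C)) (t : G.RegionNode P) :
    G.outerBoundary t.region ⊆ t.parent.region := by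
  by_cases ht : t = root G P
  · rw [ht, outerBoundary_root]
    exact Set.empty_subset _
  intro y hy
  have hp := t.parent.isPartOf hG hP
  refine (hp.subset (t.outerBoundary_subset_part_parent hG hP hy)).resolve_right fun h => ?_
  exact Set.disjoint_left.mp (hp.disjoint_boundary _ (region_isComponentOf ht)) h hy

/-- The length of a walk to the part of the root bounds the depths of the regions that contain its
first vertex. -/
theorem depth_le_length (hG : G.Connected) (hP : ∀ C, G.IsRegion C → G.IsPartOf C (P C)) {x o : V}
    (p : G.Walk x o) (ho : o ∈ (root G P).part) {t : G.RegionNode P} (hx : x ∈ t.region) :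
    t.depth ≤ p.length := by
  have hpm := isParentMap G P
  induction p generalizing t with
  | nil =>
    have h₁ := hpm.depth_le (mem_descendants_of_mem_part (m := root G P) trivial ho hx)
    rwa [hpm.depth_eq_zero (root G P) rfl] at h₁
  | @cons x y o hxy p ih =>
    rw [Walk.length_cons]
    by_cases hy : y ∈ t.region
    · exact (ih ho hy).trans (Nat.le_succ _)
    -- The edge leaves the region through its boundary, hence still ends in the parent region: one
    -- edge, one level.
    · have h₁ := ih ho (t.outerBoundary_subset_region_parent hG hP ⟨hy, x, hx, hxy⟩)
      have h₂ := hpm.depth_parent_eq t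
      omega

theorem root_part_nonempty (hG : G.Connected) (hP : ∀ C, G.IsRegion C → G.IsPartOf C (P C)) :
    (root G P).part.Nonempty :=
  ((root G P).isPartOf hG hP).inter_nonempty.mono Set.inter_subset_left

theorem exists_depth_bound (hG : G.Connected) (hP : ∀ C, G.IsRegion C → G.IsPartOf C (P C))
    (x : V) : ∃ k, ∀ t : G.RegionNode P, x ∈ t.region → t.depth ≤ k := by
  obtain ⟨o, ho⟩ := root_part_nonempty hG hP
  obtain ⟨p⟩ := hG.preconnected x o
  exact ⟨p.length, fun t ht => depth_le_length hG hP p ho ht⟩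

/-- A vertex missed by every part whose region contains it would lie in regions of all depths. -/
theorem exists_mem_part_region (hG : G.Connected) (hP : ∀ C, G.IsRegion C → G.IsPartOf C (P C))
    (x : V) : ∃ m : G.RegionNode P, x ∈ m.region ∧ x ∈ m.part := by
  have hpm := isParentMap G P
  by_contra! h
  obtain ⟨k, hk⟩ := exists_depth_bound hG hP x
  have hdeep : ∀ n, ∃ t : G.RegionNode P, x ∈ t.region ∧ t.depth = n := by
    intro n
    induction n with
    | zero => exact ⟨root G P, trivial, rfl⟩
    | succ n ih =>
      obtain ⟨t, hxt, hd⟩ := ih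
      obtain ⟨s, hs, rfl, hsr⟩ := exists_child (t := t)
        ⟨x, ⟨hxt, h t hxt⟩, rfl⟩
      refine ⟨s, hsr ▸ JoinedIn.refl ⟨hxt, h _ hxt⟩, ?_⟩
      have := hpm.depth_parent s hs
      omega
  obtain ⟨t, hxt, hd⟩ := hdeep (k + 1)
  have := hk t hxt
  omega

/-- The nodes whose parts contain `x` are the one whose region also contains `x`, and some of its
children. -/
theorem eq_or_parent_eq (hG : G.Connected) (hP : ∀ C, G.IsRegion C → G.IsPartOf C (P C)) {x : V}
    {m t : G.RegionNode P} (hm : x ∈ m.region) (hmp : x ∈ m.part) (ht : x ∈ t.part) :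
    t = m ∨ t.parent = m := by
  have hpm := isParentMap G P
  have key : ∀ s : G.RegionNode P, x ∈ s.region → x ∈ s.part → s = m := fun s hs hsp =>
    eq_of_mem_region hs hm (le_antisymm
      (hpm.depth_le (mem_descendants_of_mem_part hm hmp hs))
      (hpm.depth_le (mem_descendants_of_mem_part hs hsp hm)))
  rcases (t.isPartOf hG hP).subset ht with h | h
  · exact Or.inl (key t h ht)
  · exact Or.inr (key _ (t.outerBoundary_subset_region_parent hG hP h)
      (t.outerBoundary_subset_part_parent hG hP h))

theorem exists_adj_part (hG : G.Connected) (hP : ∀ C, G.IsRegion C → G.IsPartOf C (P C)) {x y : V}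
    (hxy : G.Adj x y) : ∃ t : G.RegionNode P, x ∈ t.part ∧ y ∈ t.part := by
  have key : ∀ x y, G.Adj x y → ∀ s t : G.RegionNode P, x ∈ s.region → x ∈ s.part →
      y ∈ t.region → y ∈ t.part → s.depth ≤ t.depth →
      ∃ t : G.RegionNode P, x ∈ t.part ∧ y ∈ t.part := by
    intro x y hxy s t hxs hxsp hyt hytp hd
    -- If `x` lies in the deeper region, both nodes have the same depth and coincide; otherwise `x`
    -- is on the boundary of that region, which its part contains.
    by_cases hxt : x ∈ t.region
    · have h := (isParentMap G P).depth_le (mem_descendants_of_mem_part hxs hxsp hxt)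
      obtain rfl := eq_of_mem_region hxs hxt (le_antisymm hd h)
      exact ⟨s, hxsp, hytp⟩
    · exact ⟨t, (t.isPartOf hG hP).boundary_subset ⟨hxt, y, hyt, hxy.symm⟩, hytp⟩
  obtain ⟨s, hxs, hxsp⟩ := exists_mem_part_region hG hP x
  obtain ⟨t, hyt, hytp⟩ := exists_mem_part_region hG hP y
  rcases le_total s.depth t.depth with h | h
  · exact key x y hxy s t hxs hxsp hyt hytp h
  · obtain ⟨t, h₁, h₂⟩ := key y x hxy.symm t s hyt hytp hxs hxsp h
    exact ⟨t, h₂, h₁⟩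

/-! ### The decomposition, its separators and its sides -/

/-- The tree-decomposition whose nodes are the regions. -/
def decomposition (hG : G.Connected) (hP : ∀ C, G.IsRegion C → G.IsPartOf C (P C)) :
    G.RootedTreeDecomposition (G.RegionNode P) where
  tree := parentGraph parent
  isTree := (isParentMap G P).parentGraph_isTree
  root := root G P
  part := part
  exists_mem_part x := (exists_mem_part_region hG hP x).imp fun _ h => h.2
  exists_edge_part _ _ h := exists_adj_part hG hP h
  inter_subset := by
    rintro t₁ t₂ t₃ p hp h₂ x ⟨hx₁, hx₃⟩
    obtain ⟨m, hm, hmp⟩ := exists_mem_part_region hG hP x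
    rcases (isParentMap G P).eq_or_of_mem_path (eq_or_parent_eq hG hP hm hmp hx₁)
      (eq_or_parent_eq hG hP hm hmp hx₃) p hp h₂ with rfl | rfl | rfl
    · exact hx₁
    · exact hx₃
    · exact hmp

theorem part_inter_part_parent (hG : G.Connected)
    (hP : ∀ C, G.IsRegion C → G.IsPartOf C (P C)) {t : G.RegionNode P} (ht : t ≠ root G P) :
    t.parent.part ∩ t.part = G.outerBoundary t.region := by
  ext y
  refine ⟨fun ⟨h₁, h₂⟩ => ?_, fun h => ⟨t.outerBoundary_subset_part_parent hG hP h,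
    (t.isPartOf hG hP).boundary_subset h⟩⟩
  exact ((t.isPartOf hG hP).subset h₂).resolve_left fun h => notMem_part_parent ht h h₁

theorem separator_parent_left (hG : G.Connected) (hP : ∀ C, G.IsRegion C → G.IsPartOf C (P C))
    {t : G.RegionNode P} (ht : t ≠ root G P) :
    (decomposition hG hP).separator t.parent t = G.outerBoundary t.region :=
  part_inter_part_parent hG hP ht

theorem separator_parent_right (hG : G.Connected) (hP : ∀ C, G.IsRegion C → G.IsPartOf C (P C))
    {t : G.RegionNode P} (ht : t ≠ root G P) :
    (decomposition hG hP).separator t t.parent = G.outerBoundary t.region :=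
  (Set.inter_comm _ _).trans (part_inter_part_parent hG hP ht)

/-- This translates orienting a tree edge away from the root into having tails in a region. -/
theorem side_sdiff_separator (hG : G.Connected) (hP : ∀ C, G.IsRegion C → G.IsPartOf C (P C))
    {t : G.RegionNode P} (ht : t ≠ root G P) :
    (decomposition hG hP).side t.parent t \ (decomposition hG hP).separator t.parent t =
      t.region := by
  have hpm := isParentMap G P
  have hside : (decomposition hG hP).tree.sideOf t.parent t = IsParentMap.descendants parent t :=
    hpm.sideOf_child ht
  rw [separator_parent_left hG hP ht, RootedTreeDecomposition.side, hside]
  ext y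
  constructor
  · rintro ⟨hy, hyb⟩
    obtain ⟨s, hs, hys⟩ := Set.mem_iUnion₂.mp hy
    rcases (s.isPartOf hG hP).subset hys with h | h
    · exact region_anti hs h
    · by_cases hst : s = t
      · exact absurd (hst ▸ h) hyb
      · exact region_anti (IsParentMap.parent_mem_descendants hs hst)
          (s.outerBoundary_subset_region_parent hG hP h)
  · intro hy
    obtain ⟨m, hm, hmp⟩ := exists_mem_part_region hG hP y
    exact ⟨Set.mem_biUnion (mem_descendants_of_mem_part hm hmp hy) hmp, fun h => h.1 hy⟩

/-- For edges oriented towards the root an inclusion is enough: a region that misses `t.region` and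
its boundary lies on the far side. -/
theorem subset_side_sdiff_separator (hG : G.Connected)
    (hP : ∀ C, G.IsRegion C → G.IsPartOf C (P C)) {t : G.RegionNode P} (ht : t ≠ root G P) :
    (t.region ∪ G.outerBoundary t.region)ᶜ ⊆
      (decomposition hG hP).side t t.parent \ (decomposition hG hP).separator t t.parent := by
  have hside : (decomposition hG hP).tree.sideOf t t.parent =
      (IsParentMap.descendants parent t)ᶜ := (isParentMap G P).sideOf_parent ht
  rw [separator_parent_right hG hP ht, RootedTreeDecomposition.side, hside]
  intro y hy
  obtain ⟨m, hm, hmp⟩ := exists_mem_part_region hG hP y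
  exact ⟨Set.mem_biUnion (x := m) (fun h => hy (Or.inl (region_anti h hm))) hmp,
    fun h => hy (Or.inr h)⟩

theorem decomposition_adj (hG : G.Connected) (hP : ∀ C, G.IsRegion C → G.IsPartOf C (P C))
    {x y : G.RegionNode P} (h : (decomposition hG hP).tree.Adj x y) :
    (y ≠ root G P ∧ y.parent = x) ∨ (x ≠ root G P ∧ x.parent = y) := by
  have hpm := isParentMap G P
  obtain ⟨hne, h | h⟩ := h
  · exact Or.inr ⟨hpm.ne_root_of_parent_ne (h ▸ hne.symm), h⟩
  · exact Or.inl ⟨hpm.ne_root_of_parent_ne (h ▸ hne), h⟩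

theorem decomposition_finiteAdhesion (hG : G.Connected)
    (hP : ∀ C, G.IsRegion C → G.IsPartOf C (P C)) : (decomposition hG hP).FiniteAdhesion := by
  intro x y hxy
  rcases decomposition_adj hG hP hxy with ⟨h, rfl⟩ | ⟨h, rfl⟩
  · rw [separator_parent_left hG hP h]
    exact (y.isRegion hG hP).finite_boundary
  · rw [separator_parent_right hG hP h]
    exact (x.isRegion hG hP).finite_boundary

theorem decomposition_connectedParts (hG : G.Connected)
    (hP : ∀ C, G.IsRegion C → G.IsPartOf C (P C)) : (decomposition hG hP).ConnectedParts :=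
  fun t => induce_connected_of_joinedIn
    ((t.isPartOf hG hP).inter_nonempty.mono Set.inter_subset_left) (t.isPartOf hG hP).joinedIn

theorem decomposition_upwardsDisjointSeparators (hG : G.Connected)
    (hP : ∀ C, G.IsRegion C → G.IsPartOf C (P C)) :
    (decomposition hG hP).UpwardsDisjointSeparators := by
  have hpm := isParentMap G P
  intro x y x' y' hxy hle hxy' hle' hyx
  obtain rfl : y.parent = x := hpm.parent_eq_of_treeLE hxy hle
  obtain rfl : y'.parent = x' := hpm.parent_eq_of_treeLE hxy' hle'
  rw [separator_parent_left hG hP (hpm.ne_root_of_parent_ne hxy.1),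
    separator_parent_left hG hP (hpm.ne_root_of_parent_ne hxy'.1), Set.disjoint_left]
  exact fun z hz hz' => hz.1 (region_anti (hpm.mem_descendants_of_treeLE hyx)
    (y'.outerBoundary_subset_region_parent hG hP hz'))

end RegionNode

/-! ### Displayed ends -/

theorem livesInComponentOf_of_eventually_mem {V : Type u} {G : SimpleGraph V} {ε : G.GraphEnd}
    {B C : Set V} (hne : C.Nonempty) (hC : ∀ a ∈ C, ∀ b ∈ C, G.JoinedIn C a b) (hCB : C ⊆ B)
    (h : ∀ R : G.Ray, R.toEnd = ε → ∃ N, ∀ n, N ≤ n → R.vertex n ∈ C) :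
    ε.LivesInComponentOf B := by
  obtain ⟨c, hc⟩ := hne
  refine ⟨(G.induce B).connectedComponentMk ⟨c, hCB hc⟩, fun R hR => ?_⟩
  obtain ⟨N, hN⟩ := h R hR
  refine ⟨N, fun n hn => ⟨hCB (hN n hn), ?_⟩⟩
  obtain ⟨p, hp⟩ := hC _ (hN n hn) c hc
  exact ConnectedComponent.sound ⟨p.induce B fun x hx => hCB (hp x hx)⟩

theorem GraphEnd.LivesInComponentOf.eventually_mem {V : Type u} {G : SimpleGraph V}
    {ε : G.GraphEnd} {B : Set V} (h : ε.LivesInComponentOf B) {R : G.Ray} (hR : R.toEnd = ε) :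
    ∃ N, ∀ n, N ≤ n → R.vertex n ∈ B := by
  obtain ⟨C, hC⟩ := h
  obtain ⟨N, hN⟩ := hC R hR
  exact ⟨N, fun n hn => (hN n hn).1⟩

theorem SubdividedStar.leaf_injective {V : Type u} {G : SimpleGraph V} (S : G.SubdividedStar) :
    Function.Injective S.leaf := by
  intro m n hmn
  by_contra hne
  exact S.leaf_ne_center m (S.disjoint m n hne _ (S.path m).end_mem_support
    (by
      rw [hmn]
      exact (S.path n).end_mem_support))

/-- A set of finite boundary that contains a tail of a ray contains every vertex dominating the end
of that ray, up to its boundary. -/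
theorem Dominates.mem_union_outerBoundary {V : Type u} {G : SimpleGraph V} {x : V}
    {ε : G.GraphEnd} (h : G.Dominates x ε) {C : Set V} (hC : (G.outerBoundary C).Finite)
    (hε : ∀ R : G.Ray, R.toEnd = ε → ∃ N, ∀ n, N ≤ n → R.vertex n ∈ C) :
    x ∈ C ∪ G.outerBoundary C := by
  by_contra hx
  simp only [Set.mem_union, not_or] at hx
  obtain ⟨S, rfl, R, hR, hS⟩ := h
  obtain ⟨N, hN⟩ := hε R hR
  have hfin : {n | S.leaf n ∉ C}.Finite := by
    refine (((Set.finite_Iio N).image R.vertex).preimage S.leaf_injective.injOn).subset ?_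
    intro n hn
    obtain ⟨k, hk⟩ := hS n
    exact ⟨k, not_le.mp fun hle => hn (hk ▸ hN k hle), hk⟩
  have hinf : {n | S.leaf n ∈ C}.Infinite := fun h => by
    have huniv : {n | S.leaf n ∉ C} ∪ {n | S.leaf n ∈ C} = Set.univ :=
      Set.eq_univ_of_forall fun n => (em (S.leaf n ∈ C)).symm
    exact Set.infinite_univ (huniv ▸ hfin.union h)
  -- Infinitely many paths of the star enter `C` through a finite boundary, so two of them share a
  -- boundary vertex. That vertex must be the centre, which is not on the boundary.
  have hmeet : ∀ n, S.leaf n ∈ C → ∃ y ∈ G.outerBoundary C, y ∈ (S.path n).support := by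
    intro n hn
    by_contra! hno
    have hj : G.JoinedIn {y | y ∈ (S.path n).support} (S.leaf n) S.center :=
      JoinedIn.symm ⟨S.path n, fun y hy => hy⟩
    exact hx.1 (hj.mem_of_disjoint_outerBoundary hno hn)
  have : Nonempty V := ⟨S.center⟩
  choose! f hf hfS using hmeet
  obtain ⟨m, hm, n, hn, hne, heq⟩ := hinf.exists_ne_map_eq_of_mapsTo (f := f) hf hC
  have hc := S.disjoint m n hne (f m) (hfS m hm) (heq ▸ hfS n hn)
  exact hx.2 (hc ▸ hf m hm)

/-! ### Ends along ascending sequences of nodes -/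

namespace RegionNode

variable {V : Type u} {G : SimpleGraph V} {P : Set V → Set V}

theorem depth_of_ascending {ρ : ℕ → G.RegionNode P}
    (hρ : ∀ n, ρ (n + 1) ≠ root G P ∧ (ρ (n + 1)).parent = ρ n) (n : ℕ) : n ≤ (ρ n).depth := by
  induction n with
  | zero => exact Nat.zero_le _
  | succ n ih =>
    have h := (isParentMap G P).depth_parent _ (hρ n).1
    rw [(hρ n).2] at h
    omega

theorem mem_descendants_of_ascending {ρ : ℕ → G.RegionNode P}
    (hρ : ∀ n, ρ (n + 1) ≠ root G P ∧ (ρ (n + 1)).parent = ρ n) {m n : ℕ} (hmn : m ≤ n) :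
    ρ n ∈ IsParentMap.descendants parent (ρ m) := by
  induction n, hmn using Nat.le_induction with
  | base => exact ⟨0, rfl⟩
  | succ n _ ih => exact IsParentMap.mem_descendants_of_parent ((hρ n).2.symm ▸ ih)

/-- The regions along an ascending sequence of nodes leave every finite set. -/
theorem exists_region_disjoint (hG : G.Connected)
    (hP : ∀ C, G.IsRegion C → G.IsPartOf C (P C)) {ρ : ℕ → G.RegionNode P}
    (hρ : ∀ n, ρ (n + 1) ≠ root G P ∧ (ρ (n + 1)).parent = ρ n) {S : Set V} (hS : S.Finite) :
    ∃ N, ∀ n, N ≤ n → ∀ x ∈ (ρ n).region, x ∉ S := by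
  choose k hk using exists_depth_bound (P := P) hG hP
  obtain ⟨K, hK⟩ := (hS.image k).bddAbove
  refine ⟨K + 1, fun n hn x hx hxS => ?_⟩
  have h₁ := hk x _ hx
  have h₂ := depth_of_ascending hρ n
  have h₃ := hK ⟨x, hxS, rfl⟩
  omega

/-- There is a ray that has a tail in every region along an ascending sequence of nodes. -/
theorem exists_ray_of_ascending (hG : G.Connected)
    (hP : ∀ C, G.IsRegion C → G.IsPartOf C (P C)) {ρ : ℕ → G.RegionNode P}
    (hρ : ∀ n, ρ (n + 1) ≠ root G P ∧ (ρ (n + 1)).parent = ρ n) :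
    ∃ R : G.Ray, ∀ m, ∃ N, ∀ n, N ≤ n → R.vertex n ∈ (ρ m).region := by
  choose f hf using fun n => ((ρ n).isRegion hG hP).nonempty
  have hanti : ∀ m n, m ≤ n → f n ∈ (ρ m).region := fun m n hmn =>
    region_anti (mem_descendants_of_ascending hρ hmn) (hf n)
  rcases hG.star_comb f with ⟨v, hv⟩ | ⟨R, hR⟩
  · exfalso
    obtain ⟨N, hN⟩ := exists_region_disjoint hG hP hρ (Set.finite_singleton v)
    have hvN : ∀ n, N ≤ n → v ∉ (ρ n).region := fun n hn h => hN n hn v h rfl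
    -- Passing to `N + 1` matters: the boundary of that region lies in region `N`, which already
    -- misses `v`. This boundary then separates `v` from almost all `f n`, which excludes a star.
    have hvb : v ∉ G.outerBoundary (ρ (N + 1)).region := fun h => by
      have h' := (ρ (N + 1)).outerBoundary_subset_region_parent hG hP h
      rw [(hρ N).2] at h'
      exact hvN N le_rfl h'
    obtain ⟨n, hn, hj⟩ := hv _ ((ρ (N + 1)).isRegion hG hP).finite_boundary hvb
      (Set.Iio (N + 1)) (Set.finite_Iio _)
    exact hvN (N + 1) (Nat.le_succ N) (hj.symm.mem_of_disjoint_outerBoundary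
      (fun y hy hy' => hy' hy) (hanti _ n (not_lt.mp hn)))
  · refine ⟨R, fun m => ?_⟩
    have hfin := ((ρ m).isRegion hG hP).finite_boundary
    refine (R.eventually_mem_or_notMem hfin).resolve_right fun ⟨N, hN⟩ => ?_
    obtain ⟨k, n, hn, hj⟩ := hR (G.outerBoundary (ρ m).region ∪ R.vertex '' Set.Iio N)
      (hfin.union ((Set.finite_Iio N).image _)) (Set.Iio m) (Set.finite_Iio m)
    have hk : N ≤ k := by
      by_contra hlt
      exact hj.left_mem (Or.inr ⟨k, not_le.mp hlt, rfl⟩)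
    exact hN k hk (hj.symm.mem_of_disjoint_outerBoundary
      (fun y hy hy' => hy' (Or.inl hy)) (hanti m n (not_lt.mp hn)))

/-- Two rays with tails in all regions along an ascending sequence of nodes are equivalent. -/
theorem equivalent_of_ascending (hG : G.Connected)
    (hP : ∀ C, G.IsRegion C → G.IsPartOf C (P C)) {ρ : ℕ → G.RegionNode P}
    (hρ : ∀ n, ρ (n + 1) ≠ root G P ∧ (ρ (n + 1)).parent = ρ n) {R R' : G.Ray}
    (hR : ∀ m, ∃ N, ∀ n, N ≤ n → R.vertex n ∈ (ρ m).region)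
    (hR' : ∀ m, ∃ N, ∀ n, N ≤ n → R'.vertex n ∈ (ρ m).region) : R.Equivalent R' := by
  refine Ray.equivalent_of_joinedIn fun S hS => ?_
  obtain ⟨m, hm⟩ := exists_region_disjoint hG hP hρ hS
  obtain ⟨N, hN⟩ := hR m
  obtain ⟨N', hN'⟩ := hR' m
  exact ⟨N, N', (((ρ m).isRegion hG hP).joinedIn _ (hN N le_rfl) _ (hN' N' le_rfl)).mono
    (hm m le_rfl)⟩

/-- The end of a ray with tails in all regions along an ascending sequence of nodes is
undominated. -/
theorem toEnd_mem_topologicalEnds (hG : G.Connected)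
    (hP : ∀ C, G.IsRegion C → G.IsPartOf C (P C)) {ρ : ℕ → G.RegionNode P}
    (hρ : ∀ n, ρ (n + 1) ≠ root G P ∧ (ρ (n + 1)).parent = ρ n) {R : G.Ray}
    (hR : ∀ m, ∃ N, ∀ n, N ≤ n → R.vertex n ∈ (ρ m).region) :
    R.toEnd ∈ G.topologicalEnds := by
  rintro ⟨x, hx⟩
  obtain ⟨N, hN⟩ := exists_region_disjoint hG hP hρ (Set.finite_singleton x)
  have hfin := ((ρ (N + 1)).isRegion hG hP).finite_boundary
  rcases hx.mem_union_outerBoundary hfin (fun R' hR' =>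
    (Ray.equivalent_of_toEnd_eq hR'.symm).eventually_mem hfin (hR (N + 1))) with h | h
  · exact hN (N + 1) (Nat.le_succ N) x h rfl
  · have h' := (ρ (N + 1)).outerBoundary_subset_region_parent hG hP h
    rw [(hρ N).2] at h'
    exact hN N le_rfl x h' rfl

/-- An ascending tail of a ray of the decomposition tree. -/
theorem exists_ascending_tail (hG : G.Connected)
    (hP : ∀ C, G.IsRegion C → G.IsPartOf C (P C)) (R : (decomposition hG hP).tree.Ray) :
    ∃ N, ∀ n, R.vertex (N + (n + 1)) ≠ root G P ∧
      (R.vertex (N + (n + 1))).parent = R.vertex (N + n) := by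
  have hpm := isParentMap G P
  obtain ⟨N, hN⟩ := hpm.exists_ascending R
  refine ⟨N, fun n => ?_⟩
  have h := hN (N + n) (Nat.le_add_right N n)
  refine ⟨hpm.ne_root_of_parent_ne ?_, h⟩
  change parent (R.vertex (N + n + 1)) ≠ R.vertex (N + n + 1)
  rw [h]
  exact fun heq => absurd (R.injective heq) (by omega)

/-- An end of the graph lives in an end of the tree if and only if its rays have tails in all
regions along an ascending ray of that end. -/
theorem livesInEnd_iff (hG : G.Connected) (hP : ∀ C, G.IsRegion C → G.IsPartOf C (P C))
    {R : (decomposition hG hP).tree.Ray} {N : ℕ}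
    (hN : ∀ n, R.vertex (N + (n + 1)) ≠ root G P ∧
      (R.vertex (N + (n + 1))).parent = R.vertex (N + n)) {Q : G.Ray} :
    (decomposition hG hP).LivesInEnd Q.toEnd R.toEnd ↔
      ∀ m, ∃ k, ∀ n, k ≤ n → Q.vertex n ∈ (R.vertex (N + m)).region := by
  have hpm := isParentMap G P
  constructor
  · intro h m
    have hside : (decomposition hG hP).tree.sideOf (R.vertex (N + m)) (R.vertex (N + (m + 1))) =
        IsParentMap.descendants parent (R.vertex (N + (m + 1))) := by
      rw [← (hN m).2]
      exact hpm.sideOf_child (hN m).1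
    -- The edge leading on from node `N + m` is used, because node `N` may be the root and have no
    -- edge to a parent.
    have hor := h (R.vertex (N + m)) (R.vertex (N + (m + 1))) (R.adj (N + m)) (by
      intro R' hR'
      rw [hside]
      refine (Ray.equivalent_of_toEnd_eq hR'.symm).eventually_mem
        ((Set.finite_singleton _).subset (IsParentMap.outerBoundary_descendants_subset _))
        ⟨N + (m + 1), fun n hn => ?_⟩
      obtain ⟨k, rfl⟩ := Nat.exists_eq_add_of_le hn
      rw [add_assoc]
      exact mem_descendants_of_ascending (ρ := fun n => R.vertex (N + n)) hN
        (Nat.le_add_right (m + 1) k))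
    obtain ⟨k, hk⟩ := GraphEnd.LivesInComponentOf.eventually_mem hor rfl
    refine ⟨k, fun n hn => ?_⟩
    have hmem := hk n hn
    rw [← (hN m).2, side_sdiff_separator hG hP (hN m).1] at hmem
    rw [← (hN m).2]
    exact region_subset_parent _ hmem
  · intro h x y hxy htail
    obtain ⟨k, hk⟩ := htail R rfl
    -- A region is connected and has finite boundary, so it holds tails of all rays of the end
    -- within a single component.
    suffices hm : ∃ m, (R.vertex (N + m)).region ⊆
        (decomposition hG hP).side x y \ (decomposition hG hP).separator x y by
      obtain ⟨m, hm⟩ := hm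
      have hreg := (R.vertex (N + m)).isRegion hG hP
      exact livesInComponentOf_of_eventually_mem hreg.nonempty hreg.joinedIn hm fun Q' hQ' =>
        (Ray.equivalent_of_toEnd_eq hQ'.symm).eventually_mem hreg.finite_boundary (h m)
    have hk' := hk (N + k) (Nat.le_add_left k N)
    rcases decomposition_adj hG hP hxy with ⟨hy, rfl⟩ | ⟨hx, rfl⟩
    · refine ⟨k, ?_⟩
      rw [side_sdiff_separator hG hP hy]
      exact region_anti ((hpm.sideOf_child hy).subset hk')
    · obtain ⟨K, hK⟩ := exists_region_disjoint hG hP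
        (ρ := fun n => R.vertex (N + n)) hN (x.isRegion hG hP).finite_boundary
      -- From `k` on the ray is not among the descendants of `x`, and from `K` on its regions miss
      -- the boundary of `x.region`. At depth at least that of `x`, a region meeting `x.region`
      -- would belong to a descendant of `x`.
      set m := max (max k K) x.depth with hm
      have hkm : k ≤ m := (le_max_left k K).trans (le_max_left _ _)
      have hKm : K ≤ m := (le_max_right k K).trans (le_max_left _ _)
      have hxm : x.depth ≤ (R.vertex (N + m)).depth :=
        (le_max_right _ _).trans (depth_of_ascending (ρ := fun n => R.vertex (N + n)) hN m)
      refine ⟨m, fun z hz => subset_side_sdiff_separator hG hP hx ?_⟩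
      rintro (hzx | hzx)
      · exact (hpm.sideOf_parent hx).subset (hk (N + m) (hkm.trans (Nat.le_add_left m N)))
          (mem_descendants_of_mem_region hzx hz hxm)
      · exact hK m hKm z hz hzx

theorem decomposition_displays (hG : G.Connected)
    (hP : ∀ C, G.IsRegion C → G.IsPartOf C (P C)) :
    (decomposition hG hP).Displays G.topologicalEnds := by
  have hpm := isParentMap G P
  refine ⟨fun ω => ?_, fun ε hε => ?_⟩
  · obtain ⟨R, rfl⟩ := Quotient.exists_rep ω
    change (∃! ε, (decomposition hG hP).LivesInEnd ε R.toEnd) ∧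
      ∀ ε, (decomposition hG hP).LivesInEnd ε R.toEnd → ε ∈ G.topologicalEnds
    obtain ⟨N, hN⟩ := exists_ascending_tail hG hP R
    obtain ⟨Q, hQ⟩ := exists_ray_of_ascending hG hP (ρ := fun n => R.vertex (N + n)) hN
    refine ⟨⟨Q.toEnd, (livesInEnd_iff hG hP hN).mpr hQ, fun ε hε => ?_⟩, fun ε hε => ?_⟩
    · obtain ⟨Q', rfl⟩ := Quotient.exists_rep ε
      exact Quotient.sound (equivalent_of_ascending hG hP (ρ := fun n => R.vertex (N + n)) hN
        ((livesInEnd_iff hG hP hN (Q := Q')).mp hε) hQ)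
    · obtain ⟨Q', rfl⟩ := Quotient.exists_rep ε
      exact toEnd_mem_topologicalEnds hG hP (ρ := fun n => R.vertex (N + n)) hN
        ((livesInEnd_iff hG hP hN (Q := Q')).mp hε)
  · obtain ⟨Q, rfl⟩ := Quotient.exists_rep ε
    -- An undominated end always passes from a region to one of its children; iterating from the
    -- root gives the ray of the tree.
    have hstep : ∀ t : G.RegionNode P, (∃ N, ∀ n, N ≤ n → Q.vertex n ∈ t.region) →
        ∃ s : G.RegionNode P, (s ≠ root G P ∧ s.parent = t) ∧
          ∃ N, ∀ n, N ≤ n → Q.vertex n ∈ s.region := by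
      intro t ht
      obtain ⟨D, hD, hQD⟩ := (t.isPartOf hG hP).exists_component Q hε ht
      obtain ⟨s, hs, hst, rfl⟩ := exists_child hD
      exact ⟨s, ⟨hs, hst⟩, hQD⟩
    choose! g hg hgQ using hstep
    set ρ : ℕ → G.RegionNode P := fun n => g^[n] (root G P) with hρdef
    have hρQ : ∀ n, ∃ N, ∀ k, N ≤ k → Q.vertex k ∈ (ρ n).region := by
      intro n
      induction n with
      | zero => exact ⟨0, fun _ _ => trivial⟩
      | succ n ih =>
        simp only [hρdef, Function.iterate_succ_apply']
        exact hgQ _ ih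
    have hρ : ∀ n, ρ (n + 1) ≠ root G P ∧ (ρ (n + 1)).parent = ρ n := by
      intro n
      have := hg _ (hρQ n)
      simp only [hρdef, Function.iterate_succ_apply']
      exact this
    have hdepth : ∀ n, (ρ n).depth = n := by
      intro n
      induction n with
      | zero => rfl
      | succ n ih =>
        have h := hpm.depth_parent _ (hρ n).1
        rw [(hρ n).2] at h
        omega
    let R : (decomposition hG hP).tree.Ray :=
      ⟨ρ, fun m n hmn => by rw [← hdepth m, ← hdepth n, hmn], fun n => by
        have h := hpm.parentGraph_adj (hρ n).1
        rw [(hρ n).2] at h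
        exact h.symm⟩
    have hR : ∀ n, R.vertex (0 + (n + 1)) ≠ root G P ∧
        (R.vertex (0 + (n + 1))).parent = R.vertex (0 + n) := by
      intro n
      simpa only [zero_add] using hρ n
    refine ⟨R.toEnd, (livesInEnd_iff hG hP hR).mpr fun m => ?_⟩
    rw [zero_add]
    exact hρQ m

end RegionNode

end SimpleGraph

theorem mainTheorem1 {V : Type u} (G : SimpleGraph V) (hG : G.Connected) :
    ∃ (W : Type u) (D : G.RootedTreeDecomposition W),
      D.FiniteAdhesion ∧ D.ConnectedParts ∧ D.UpwardsDisjointSeparators ∧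
        D.Displays G.topologicalEnds := by
  have hex : ∀ C, ∃ P, G.IsRegion C → G.IsPartOf C P := fun C => by
    by_cases hC : G.IsRegion C
    · obtain ⟨P, hP⟩ := hC.exists_isPartOf hG
      exact ⟨P, fun _ => hP⟩
    -- The value outside regions is irrelevant; it only makes the choice of parts a total function.
    · exact ⟨∅, fun h => absurd h hC⟩
  choose P hP using hex
  exact ⟨_, SimpleGraph.RegionNode.decomposition hG hP,
    SimpleGraph.RegionNode.decomposition_finiteAdhesion hG hP,
    SimpleGraph.RegionNode.decomposition_connectedParts hG hP,
    SimpleGraph.RegionNode.decomposition_upwardsDisjointSeparators hG hP,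
    SimpleGraph.RegionNode.decomposition_displays hG hP⟩
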